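/- Let $d\ge 1$ be odd, $0<a<b$ and $L>1$. For $k\ge 0$ let $Y_{k,\ell}$, $\ell=1,\dots,a_k$, be real-valued functions which form an orthonormal basis, in $L^2(\mathbb S^{d-1},d\theta)$, of the space of complex harmonic homogeneous polynomials of degree $k$ on $\mathbb R^d$, where $d\theta$ is the surface measure. Put $\mathbb A_{a,b}=\{z\in\mathbb C: a<|z|<b\}$ and $\mathcal A_{a,b}=\mathbb A_{a,b}\times\mathbb S^{d-1}$. Let $H^2(\mathbb A_{a,b})$ be the space of analytic $f$ on $\mathbb A_{a,b}$ for which $M_2(f;r)^2=\frac1{2\pi}\int_0^{2\pi}|f(re^{i\varphi})|^2d\varphi$ is bounded on $a<r<b$, with $\|f\|^2=\lim_{r\to a+}M_2(f;r)^2+\lim_{r\to b-}M_2(f;r)^2$, and let $H^{2,k}(\mathbb A_{a,b})$ be the closure in it of $\operatorname{span}\{z^{k+2j},\,z^{-d-k+2+2j}: j\ge 0\}$. The space $H^2_L(\mathcal A_{a,b})$ consists of the functions $f(z,\theta)=\sum_{k,\ell}f_{k,\ell}(z)Y_{k,\ell}(\theta)$ with $f_{k,\ell}\in H^{2,k}(\mathbb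 A_{a,b})$ and $\sum_{k,\ell}\|f_{k,\ell}\|^2L^{2k}<\infty$. The boundary limit $f^*$ of $f$ is the function on $\partial\mathbb A_{a,b}\times\mathbb S^{d-1}$ such that, in $L^2((0,2\pi)\times\mathbb S^{d-1})$, $f(re^{i\varphi},\theta)\to f^*(ae^{i\varphi},\theta)$ as $r\to a+$ and $f(re^{i\varphi},\theta)\to f^*(be^{i\varphi},\theta)$ as $r\to b-$. For square integrable functions $u,v$ on $\partial\mathbb A_{a,b}\times\mathbb S^{d-1}$, with coefficients $u_{k,\ell}(\tau)=\int_{\mathbb S^{d-1}}u(\tau,\theta)Y_{k,\ell}(\theta)\,d\theta$ and $v_{k,\ell}$ likewise, consider the (bilinear) weighted pairing $$\langle u,v\rangle_{H^2_L}=\sum_{k,\ell}L^{2k}\,\frac1{2\pi}\int_0^{2\pi}\Big(u_{k,\ell}v_{k,\ell}(be^{i\varphi})+u_{k,\ell}v_{k,\ell}(ae^{i\varphi})\Big)d\varphi .$$ For $z\in\mathbb A_{a,b}$ let $$K_k(z,\tau)=\sum_{j\ge0}\Big(\frac z\tau\Big)^{k+2j}+\sum_{\substack{j\ge 0\\ m=-d-k+2+2j\ge0}}\Big(\frac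 z\tau\Big)^{m}\ \text{ for }|\tau|=b,\qquad K_k(z,\tau)=\sum_{\substack{j\ge 0\\ m=-d-k+2+2j<0}}\Big(\frac z\tau\Big)^{m}\ \text{ for }|\tau|=a,$$ and $$K(z,\theta;\tau,\theta')=\sum_{k=0}^\infty\sum_{\ell=1}^{a_k}L^{-2k}K_k(z,\tau)Y_{k,\ell}(\theta)Y_{k,\ell}(\theta').$$ Theorem. The series defining $K(z,\theta;\tau,\theta')$ converges absolutely for all $(z,\theta)\in\mathcal A_{a,b}$, $|\tau|\in\{a,b\}$, $\theta'\in\mathbb S^{d-1}$. Every $f\in H^2_L(\mathcal A_{a,b})$ has a boundary limit $f^*$, and $K$ reproduces $f$ from it: for all $(z,\theta)\in\mathcal A_{a,b}$ the function $K(z,\theta;\cdot,\cdot)$ is square integrable on $\partial\mathbb A_{a,b}\times\mathbb S^{d-1}$, the series defining the pairing converges absolutely, and $$\langle K(z,\theta;\cdot,\cdot),f^*\rangle_{H^2_L}=f(z,\theta).$$ -/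

import Mathlib

open Filter Topology MeasureTheory

noncomputable section

namespace PolyHardy

/-! ### Spherical harmonics -/

/-- The unit sphere of `ℝᵈ`. -/
abbrev Sph (d : ℕ) : Type := Metric.sphere (0 : EuclideanSpace ℝ (Fin d)) 1

/-- The rotation invariant surface measure on the unit sphere. -/
def sphMeasure (d : ℕ) : Measure (Sph d) :=
  (volume : Measure (EuclideanSpace ℝ (Fin d))).toSphere

/-- The Laplace operator on complex polynomials in `d` variables. -/
def polyLaplacian (d : ℕ) : MvPolynomial (Fin d) ℂ →ₗ[ℂ] MvPolynomial (Fin d) ℂ :=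
  ∑ i : Fin d, (MvPolynomial.pderiv i).toLinearMap ∘ₗ (MvPolynomial.pderiv i).toLinearMap

/-- The complex vector space of harmonic homogeneous polynomials of degree `k`. -/
def solidHarmonics (d k : ℕ) : Submodule ℂ (MvPolynomial (Fin d) ℂ) :=
  MvPolynomial.homogeneousSubmodule (Fin d) ℂ k ⊓ LinearMap.ker (polyLaplacian d)

/-- The dimension `a_k` of the space of solid harmonics of degree `k`. -/
def harmDim (d k : ℕ) : ℕ := Module.finrank ℂ (solidHarmonics d k)

/-- The set of pairs `(k, ℓ)` with `k ≥ 0`, and `ℓ` running through `a_k` values. -/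
abbrev HarmIndex (d : ℕ) : Type := Σ k : ℕ, Fin (harmDim d k)

/-- For every `k`, the real-valued functions `Y k ℓ` form an orthonormal basis of the space of solid
harmonics of degree `k`, with respect to the scalar product of `L²` of the sphere. (There are
exactly `a_k` of them and they are orthonormal, hence they span. Nothing is asked about
different degrees.) -/
structure IsHarmonicBasis {d : ℕ}
    (Y : (k : ℕ) → Fin (harmDim d k) → EuclideanSpace ℝ (Fin d) → ℝ) : Prop where
  mem : ∀ k l, ∃ p ∈ solidHarmonics d k, ∀ x : EuclideanSpace ℝ (Fin d),
    MvPolynomial.eval (fun i => ((x i : ℝ) : ℂ)) p = ((Y k l x : ℝ) : ℂ)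
  orthonormal : ∀ k l m,
    ∫ θ : Sph d, Y k l θ * Y k m θ ∂(sphMeasure d) = if l = m then 1 else 0

/-! ### The Hardy space of a planar annulus and its component spaces -/

/-- The open annulus `a < |z| < b` in `ℂ`. -/
def annulus (a b : ℝ) : Set ℂ := {z : ℂ | a < ‖z‖ ∧ ‖z‖ < b}

/-- The square of the mean `M₂(f; r)`. -/
def meanSq (f : ℂ → ℂ) (r : ℝ) : ℝ := Real.circleAverage (fun z => ‖f z‖ ^ 2) 0 r

/-- `f` belongs to the Hardy space `H²` of the annulus: it is analytic there and
`M₂(f; r)` is bounded for `a < r < b`. -/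
def MemHardy (a b : ℝ) (f : ℂ → ℂ) : Prop :=
  DifferentiableOn ℂ f (annulus a b) ∧ BddAbove (meanSq f '' Set.Ioo a b)

/-- The square of the `H²` norm: the limits of `M₂(f; r)²` at the two boundary circles (these exist
for every `f` in `H²`) are added up. -/
def hardyNormSq (a b : ℝ) (f : ℂ → ℂ) : ℝ :=
  limUnder (𝓝[>] a) (meanSq f) + limUnder (𝓝[<] b) (meanSq f)

/-- The linear span of the functions `z ^ (k + 2 j)` and `z ^ (-d - k + 2 + 2 j)`, `j ≥ 0`. -/
def genSpace (d k : ℕ) : Submodule ℂ (ℂ → ℂ) :=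
  Submodule.span ℂ
    (Set.range (fun j : ℕ => fun z : ℂ => z ^ (k + 2 * j)) ∪
      Set.range (fun j : ℕ => fun z : ℂ => z ^ (-(d : ℤ) - k + 2 + 2 * j)))

/-- `f` belongs to the component Hardy space `H^{2,k}`, the closure of `genSpace d k` in the
Hardy space of the annulus. -/
def MemComponent (d k : ℕ) (a b : ℝ) (f : ℂ → ℂ) : Prop :=
  MemHardy a b f ∧ ∀ ε > 0, ∃ v ∈ genSpace d k, hardyNormSq a b (f - v) < ε

/-! ### The polyharmonic Hardy space -/

/-- `f` belongs to the polyharmonic Hardy space `H²_L` of the complexified annulus: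
`f(z, θ) = ∑ f_{k,ℓ}(z) Y_{k,ℓ}(θ)`, where `f_{k,ℓ}` is in `H^{2,k}` and
`∑ ‖f_{k,ℓ}‖² L^{2k} < ∞`. -/
def MemPolyHardy {d : ℕ} (Y : (k : ℕ) → Fin (harmDim d k) → EuclideanSpace ℝ (Fin d) → ℝ)
    (a b L : ℝ) (f : ℂ → Sph d → ℂ) : Prop :=
  ∃ F : HarmIndex d → ℂ → ℂ,
    (∀ p, MemComponent d p.1 a b (F p)) ∧
    Summable (fun p : HarmIndex d => hardyNormSq a b (F p) * L ^ (2 * p.1)) ∧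
    ∀ z ∈ annulus a b, ∀ θ : Sph d,
      HasSum (fun p : HarmIndex d => F p z * ((Y p.1 p.2 θ : ℝ) : ℂ)) (f z θ)

/-- The product of the Lebesgue measure `dφ` on `(0, 2π]` with the surface measure `dθ`. -/
def circSphMeasure (d : ℕ) : Measure (ℝ × Sph d) :=
  ((volume : Measure ℝ).restrict (Set.Ioc 0 (2 * Real.pi))).prod (sphMeasure d)

/-- The function `(φ, θ) ↦ u(r e^{iφ}, θ)`. -/
def slice {d : ℕ} (u : ℂ → Sph d → ℂ) (r : ℝ) : ℝ × Sph d → ℂ :=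
  fun q => u (circleMap 0 r q.1) q.2

/-- `u` is square integrable on the boundary of the complexified annulus, that is, on each of its
two parts `|τ| = a` and `|τ| = b`. -/
def IsL2Boundary {d : ℕ} (a b : ℝ) (u : ℂ → Sph d → ℂ) : Prop :=
  MemLp (slice u a) 2 (circSphMeasure d) ∧ MemLp (slice u b) 2 (circSphMeasure d)

/-- `g`, a function on the boundary of the complexified annulus, is the boundary limit `f*` of `f`:
`f(r e^{iφ}, θ)` tends in `L²` to `g(a e^{iφ}, θ)` as `r → a+` and to
`g(b e^{iφ}, θ)` as `r → b-`. -/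
def IsBoundaryLimit {d : ℕ} (a b : ℝ) (f g : ℂ → Sph d → ℂ) : Prop :=
  IsL2Boundary a b g ∧
  Tendsto (fun r : ℝ => eLpNorm (slice f r - slice g a) 2 (circSphMeasure d)) (𝓝[>] a) (𝓝 0) ∧
  Tendsto (fun r : ℝ => eLpNorm (slice f r - slice g b) 2 (circSphMeasure d)) (𝓝[<] b) (𝓝 0)

/-- The Laplace-Fourier coefficient `u_{k,ℓ}(τ) = ∫ u(τ, θ) Y_{k,ℓ}(θ) dθ`. -/
def coeff {d : ℕ} (Y : (k : ℕ) → Fin (harmDim d k) → EuclideanSpace ℝ (Fin d) → ℝ)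
    (u : ℂ → Sph d → ℂ) (p : HarmIndex d) (τ : ℂ) : ℂ :=
  ∫ θ : Sph d, u τ θ * ((Y p.1 p.2 θ : ℝ) : ℂ) ∂(sphMeasure d)

/-- The pairing of the Hardy space of the planar annulus on boundary functions,
`(1/2π) ∫ u v (b e^{iφ}) dφ + (1/2π) ∫ u v (a e^{iφ}) dφ`. As in every Cauchy type
formula, the second argument is not conjugated. -/
def circPairing (a b : ℝ) (u v : ℂ → ℂ) : ℂ :=
  Real.circleAverage (fun τ => u τ * v τ) 0 b + Real.circleAverage (fun τ => u τ * v τ) 0 a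

/-- The weighted pairing `∑_{k,ℓ} ⟨u_{k,ℓ}, v_{k,ℓ}⟩ L^{2k}` of the square integrable
boundary functions `u` and `v` converges and its value is `s`. -/
def HasPairing {d : ℕ} (Y : (k : ℕ) → Fin (harmDim d k) → EuclideanSpace ℝ (Fin d) → ℝ)
    (a b L : ℝ) (u v : ℂ → Sph d → ℂ) (s : ℂ) : Prop :=
  IsL2Boundary a b u ∧ IsL2Boundary a b v ∧
  HasSum (fun p : HarmIndex d =>
    circPairing a b (coeff Y u p) (coeff Y v p) * (L : ℂ) ^ (2 * p.1)) s

/-! ### The kernels -/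

/-- `∑_{j ≥ 0} (z/τ)^{k+2j}`. -/
def kerOne (k : ℕ) (z τ : ℂ) : ℂ := ∑' j : ℕ, (z / τ) ^ (k + 2 * j)

/-- The sum of `(z/τ)^m` over all `m = -d-k+2+2j ≥ 0`, `j ≥ 0`. -/
def kerTwo (d k : ℕ) (z τ : ℂ) : ℂ :=
  ∑' j : {j : ℕ // 0 ≤ -(d : ℤ) - k + 2 + 2 * j}, (z / τ) ^ (-(d : ℤ) - k + 2 + 2 * (j : ℕ))

/-- The (finite) sum of `(z/τ)^m` over all `m = -d-k+2+2j < 0`, `j ≥ 0`. -/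
def kerThree (d k : ℕ) (z τ : ℂ) : ℂ :=
  ∑' j : {j : ℕ // -(d : ℤ) - k + 2 + 2 * j < 0}, (z / τ) ^ (-(d : ℤ) - k + 2 + 2 * (j : ℕ))

open Classical in
/-- The Cauchy type kernel `K_k(z, τ)` of `H^{2,k}`, for `|τ| = b` and `|τ| = a`; the value `0`
elsewhere is never used. -/
def compKernel (d k : ℕ) (a b : ℝ) (z τ : ℂ) : ℂ :=
  if ‖τ‖ = b then kerOne k z τ + kerTwo d k z τ
  else if ‖τ‖ = a then kerThree d k z τ
  else 0

/-- The summand `L^{-2k} K_k(z, τ) Y_{k,ℓ}(θ) Y_{k,ℓ}(θ')` of the Cauchy type kernel. -/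
def kernelTerm {d : ℕ} (Y : (k : ℕ) → Fin (harmDim d k) → EuclideanSpace ℝ (Fin d) → ℝ)
    (a b L : ℝ) (z : ℂ) (θ : Sph d) (τ : ℂ) (θ' : Sph d) (p : HarmIndex d) : ℂ :=
  ((L : ℂ) ^ (2 * p.1))⁻¹ * compKernel d p.1 a b z τ *
    ((Y p.1 p.2 θ : ℝ) : ℂ) * ((Y p.1 p.2 θ' : ℝ) : ℂ)

/-- The Cauchy type kernel `K(z, θ; τ, θ')` of the polyharmonic Hardy space. -/
def cauchyKernel {d : ℕ} (Y : (k : ℕ) → Fin (harmDim d k) → EuclideanSpace ℝ (Fin d) → ℝ)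
    (a b L : ℝ) (z : ℂ) (θ : Sph d) (τ : ℂ) (θ' : Sph d) : ℂ :=
  ∑' p : HarmIndex d, kernelTerm Y a b L z θ τ θ' p

end PolyHardy

end

/-!
For a function `f` of the polyharmonic Hardy space, `f(z, θ) = ∑ c_{k,ℓ,m} zᵐ Y_{k,ℓ}(θ)`, where the
numbers `c_{k,ℓ,m}`, `m ∈ ℤ`, are the Laurent coefficients of the component `f_{k,ℓ}`. The functions
`e^{imφ} Y_{k,ℓ}(θ)` are orthogonal in `L²((0, 2π) × 𝕊)`, so everything can be read off from these
coefficients.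

*Spherical harmonics.* Harmonics of different degrees are orthogonal: a solid harmonic of degree `k`
is an eigenvector, with eigenvalue `-2k`, of the operator `Δ - 2 x·∇`, which is symmetric for the
weight `exp(-|x|²)` (`gaussMoment_grad_mul_grad`); polar coordinates turn the Gaussian moment of a
homogeneous polynomial into a multiple of its integral over the sphere
(`gaussMoment_eq_radialMoment_mul`). The sum `∑ₗ Y_{k,ℓ}(θ)²` is invariant under rotations, hence
constant and equal to `a_k / |𝕊|` (`IsHarmonicBasis.sum_sq_eq`). As `a_k` grows polynomially
(`harmDim_le`), the factors `L^{-2k}` make the kernel series converge absolutely and uniformly.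

*The annulus.* By Parseval's identity the norm of the Hardy space of the annulus is
`∑ |c_m|² (a^{2m} + b^{2m})` (`MemHardy.hasSum_hardyNormSq`). Each coefficient is therefore a
continuous functional, and those of a function in `H^{2,k}` vanish outside the exponents `k + 2j` and
`-d - k + 2 + 2j` (`MemComponent.annCoeff_eq_zero`). For odd `d` the two progressions are disjoint,
and on each boundary circle the kernel `K_k(z, τ)` is the sum of `(z/τ)ᵐ` over a set of these
exponents, every exponent occurring on exactly one of the two circles (`hasSum_compKernel`).

*Boundary limits.* The isometry `synthesis` from `ℓ²` to `L²((0, 2π) × 𝕊)` maps the coefficients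
`√(2π) c_{k,ℓ,m} rᵐ` to the slice of `f` at radius `r` (`slice_ae_eq_synthesis`). By dominated
convergence these sequences converge in `ℓ²` as `r` tends to `a` or `b` (`tendsto_modeVec`), so the
boundary limit exists, is unique up to null sets, and the component of index `(k, ℓ)` of it has the
Laurent coefficients `c_{k,ℓ,m}` on both circles (`laurentCoeff_coeff`). Pairing it with `K_k(z, ·)`
gives `∑ c_{k,ℓ,m} zᵐ = f_{k,ℓ}(z)` (`circleAverage_add_circleAverage_compKernel`), and the weights
`L^{2k}` and `L^{-2k}` cancel.
-/

noncomputable section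

namespace PolyHardy

/-! ### Spherical harmonics of different degrees are orthogonal -/

/-- The complex polynomial `p` as a function on `ℝᵈ`. -/
def polyFun {d : ℕ} (p : MvPolynomial (Fin d) ℂ) (x : EuclideanSpace ℝ (Fin d)) : ℂ :=
  MvPolynomial.eval (fun i => ((x i : ℝ) : ℂ)) p

lemma continuous_polyFun {d : ℕ} (p : MvPolynomial (Fin d) ℂ) : Continuous (polyFun p) := by
  unfold polyFun
  refine (MvPolynomial.continuous_eval p).comp ?_
  fun_prop

lemma polyFun_add {d : ℕ} (p q : MvPolynomial (Fin d) ℂ) (x) :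
    polyFun (p + q) x = polyFun p x + polyFun q x := by simp [polyFun]

lemma polyFun_mul {d : ℕ} (p q : MvPolynomial (Fin d) ℂ) (x) :
    polyFun (p * q) x = polyFun p x * polyFun q x := by simp [polyFun]

lemma polyFun_smul {d : ℕ} {k : ℕ} {p : MvPolynomial (Fin d) ℂ} (hp : p.IsHomogeneous k) (r : ℝ)
    (x : EuclideanSpace ℝ (Fin d)) : polyFun p (r • x) = (r : ℂ) ^ k * polyFun p x := by
  unfold polyFun
  rw [MvPolynomial.eval_eq, MvPolynomial.eval_eq, Finset.mul_sum]
  refine Finset.sum_congr rfl fun s hs => ?_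
  have h : ∑ i ∈ s.support, s i = k := by
    rw [hp.degree_eq_sum_deg_support hs]
  simp only [PiLp.smul_apply, smul_eq_mul, Complex.ofReal_mul, mul_pow, Finset.prod_mul_distrib]
  rw [Finset.prod_pow_eq_pow_sum, h]
  ring

lemma hasLineDerivAt_polyFun {d : ℕ} (p : MvPolynomial (Fin d) ℂ) (i : Fin d) (x) :
    HasLineDerivAt ℝ (polyFun p) (polyFun (MvPolynomial.pderiv i p) x) x
      (EuclideanSpace.single i 1) := by
  unfold HasLineDerivAt
  induction p using MvPolynomial.induction_on with
  | C a => simpa [polyFun] using hasDerivAt_const (0 : ℝ) a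
  | add p q hp hq => simpa [polyFun_add, map_add, Pi.add_def] using hp.add hq
  | mul_X p j hp =>
    have hj : HasDerivAt (fun t : ℝ => ((((x + t • EuclideanSpace.single i (1 : ℝ)) j : ℝ)) : ℂ))
        (if i = j then 1 else 0) 0 := by
      have : HasDerivAt (fun t : ℝ => (x + t • EuclideanSpace.single i (1 : ℝ)) j)
          (if i = j then 1 else 0) 0 := by
        by_cases h : i = j
        · subst h
          simpa using (hasDerivAt_id (0 : ℝ)).const_add (x i)
        · have h' : j ≠ i := fun e => h e.symm
          simpa [h, h'] using hasDerivAt_const (0 : ℝ) (x j)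
      convert! this.ofReal_comp using 1
      split_ifs <;> simp
    have := hp.mul hj
    convert! this using 1
    · ext t
      simp [polyFun]
    · simp [polyFun, Derivation.leibniz, MvPolynomial.pderiv_X, Pi.single_apply, eq_comm]
      split_ifs
      · ring
      · simp; ring

lemma norm_polyFun_monomial_le {d : ℕ} (s : Fin d →₀ ℕ) (c : ℂ) (x : EuclideanSpace ℝ (Fin d)) :
    ‖polyFun (MvPolynomial.monomial s c) x‖ ≤ ‖c‖ * ‖x‖ ^ (∑ i, s i) := by
  unfold polyFun
  rw [MvPolynomial.eval_monomial, norm_mul, Finsupp.prod_fintype _ _ (by simp), norm_prod,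
    ← Finset.prod_pow_eq_pow_sum]
  gcongr with i
  rw [norm_pow, Complex.norm_real]
  gcongr
  exact PiLp.norm_apply_le x i

lemma integrable_norm_pow_mul_gaussian {d : ℕ} (hd : 1 ≤ d) (n : ℕ) :
    Integrable (fun x : EuclideanSpace ℝ (Fin d) => ‖x‖ ^ n * Real.exp (-‖x‖ ^ 2)) := by
  have : Nonempty (Fin d) := ⟨⟨0, hd⟩⟩
  have : Nontrivial (EuclideanSpace ℝ (Fin d)) := inferInstance
  rw [integrable_fun_norm_addHaar (μ := (volume : Measure (EuclideanSpace ℝ (Fin d))))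
    (f := fun r => r ^ n * Real.exp (-r ^ 2))]
  have h := (integrable_rpow_mul_exp_neg_mul_sq (b := 1) one_pos
    (s := ((d - 1 + n : ℕ) : ℝ)) (by
      have : (0 : ℝ) ≤ ((d - 1 + n : ℕ) : ℝ) := Nat.cast_nonneg _
      linarith)).integrableOn (s := Set.Ioi 0)
  refine h.congr_fun (fun r _ => ?_) measurableSet_Ioi
  simp only [Real.rpow_natCast, pow_add, smul_eq_mul, finrank_euclideanSpace, Fintype.card_fin]
  ring_nf

/-- The Gaussian weight, as a complex valued function. -/
def gaussian {d : ℕ} (x : EuclideanSpace ℝ (Fin d)) : ℂ := ((Real.exp (-‖x‖ ^ 2) : ℝ) : ℂ)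

lemma continuous_gaussian {d : ℕ} : Continuous (gaussian (d := d)) := by
  unfold gaussian
  fun_prop

lemma integrable_polyFun_mul_gaussian {d : ℕ} (hd : 1 ≤ d) (p : MvPolynomial (Fin d) ℂ) :
    Integrable (fun x => polyFun p x * gaussian x) := by
  induction p using MvPolynomial.induction_on' with
  | monomial s c =>
    refine ((integrable_norm_pow_mul_gaussian hd (∑ i, s i)).const_mul ‖c‖).mono'
      (((continuous_polyFun _).mul continuous_gaussian).aestronglyMeasurable) (ae_of_all _ ?_)
    intro x
    rw [norm_mul, gaussian, Complex.norm_real, Real.norm_of_nonneg (Real.exp_nonneg _), ← mul_assoc]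
    gcongr
    exact norm_polyFun_monomial_le s c x
  | add p q hp hq => simpa [polyFun_add, add_mul, Pi.add_def] using hp.add hq

/-- The moment `∫ p(x) exp(-|x|²) dx`. -/
def gaussMoment {d : ℕ} (p : MvPolynomial (Fin d) ℂ) : ℂ :=
  ∫ x : EuclideanSpace ℝ (Fin d), polyFun p x * gaussian x

lemma gaussMoment_add {d : ℕ} (hd : 1 ≤ d) (p q : MvPolynomial (Fin d) ℂ) :
    gaussMoment (p + q) = gaussMoment p + gaussMoment q := by
  unfold gaussMoment
  rw [← integral_add (integrable_polyFun_mul_gaussian hd p) (integrable_polyFun_mul_gaussian hd q)]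
  simp [polyFun_add, add_mul]

lemma gaussMoment_C_mul {d : ℕ} (c : ℂ) (p : MvPolynomial (Fin d) ℂ) :
    gaussMoment (MvPolynomial.C c * p) = c * gaussMoment p := by
  unfold gaussMoment
  rw [← integral_const_mul]
  simp [polyFun, mul_assoc]

lemma gaussMoment_sum {d : ℕ} (hd : 1 ≤ d) {ι : Type*} (s : Finset ι)
    (p : ι → MvPolynomial (Fin d) ℂ) :
    gaussMoment (∑ i ∈ s, p i) = ∑ i ∈ s, gaussMoment (p i) := by
  classical
  induction s using Finset.induction_on with
  | empty => simp [gaussMoment, polyFun]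
  | insert a s ha ih => rw [Finset.sum_insert ha, Finset.sum_insert ha, gaussMoment_add hd, ih]

lemma hasLineDerivAt_gaussian {d : ℕ} (i : Fin d) (x : EuclideanSpace ℝ (Fin d)) :
    HasLineDerivAt ℝ (gaussian (d := d)) (-2 * ((x i : ℝ) : ℂ) * gaussian x) x
      (EuclideanSpace.single i 1) := by
  unfold HasLineDerivAt
  have h1 : HasDerivAt (fun t : ℝ => -‖x + t • EuclideanSpace.single i (1 : ℝ)‖ ^ 2)
      (-(2 * x i)) 0 := by
    have e : (fun t : ℝ => -‖x + t • EuclideanSpace.single i (1 : ℝ)‖ ^ 2) =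
        fun t : ℝ => -(‖x‖ ^ 2 + 2 * (t * x i) + t ^ 2) := by
      ext t
      rw [norm_add_sq_real, inner_smul_right, norm_smul]
      simp [EuclideanSpace.inner_single_right]
    rw [e]
    have := ((((hasDerivAt_id (0 : ℝ)).mul_const (x i)).const_mul 2).const_add (‖x‖ ^ 2)).add
      ((hasDerivAt_id (0 : ℝ)).pow 2)
    convert! this.neg using 1
    simp
  have h2 := h1.exp.ofReal_comp
  convert! h2 using 1
  simp [gaussian]
  ring

/-- Integration by parts against the Gaussian weight. -/
lemma gaussMoment_pderiv {d : ℕ} (hd : 1 ≤ d) (i : Fin d) (p : MvPolynomial (Fin d) ℂ) :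
    gaussMoment (MvPolynomial.pderiv i p) = 2 * gaussMoment (MvPolynomial.X i * p) := by
  have hX : Integrable (fun x : EuclideanSpace ℝ (Fin d) =>
      polyFun p x * (-2 * ((x i : ℝ) : ℂ) * gaussian x)) := by
    refine (integrable_polyFun_mul_gaussian hd (MvPolynomial.C (-2) * MvPolynomial.X i * p)).congr
      (ae_of_all _ fun x => ?_)
    simp [polyFun]
    ring
  have := integral_bilinear_hasLineDerivAt_right_eq_neg_left_of_integrable
    (μ := (volume : Measure (EuclideanSpace ℝ (Fin d)))) (B := ContinuousLinearMap.mul ℝ ℂ)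
    (f := polyFun p) (f' := fun x => polyFun (MvPolynomial.pderiv i p) x) (g := gaussian)
    (g' := fun x => -2 * ((x i : ℝ) : ℂ) * gaussian x) (v := EuclideanSpace.single i 1)
    (by simpa using integrable_polyFun_mul_gaussian hd (MvPolynomial.pderiv i p))
    (by simpa using hX)
    (by simpa using integrable_polyFun_mul_gaussian hd p)
    (fun x _ => hasLineDerivAt_polyFun p i x) (fun x _ => hasLineDerivAt_gaussian i x)
  simp only [ContinuousLinearMap.mul_apply'] at this
  unfold gaussMoment
  rw [← neg_eq_iff_eq_neg] at this
  rw [← this, ← integral_neg, ← integral_const_mul]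
  congr 1
  ext x
  simp [polyFun]
  ring

lemma mem_solidHarmonics {d k : ℕ} {p : MvPolynomial (Fin d) ℂ} :
    p ∈ solidHarmonics d k ↔
      p.IsHomogeneous k ∧ ∑ i, MvPolynomial.pderiv i (MvPolynomial.pderiv i p) = 0 := by
  simp [solidHarmonics, polyLaplacian, MvPolynomial.mem_homogeneousSubmodule]

/-- Green's formula for the Gaussian weight: the operator `Δ - 2 x·∇` is symmetric, and a solid
harmonic of degree `k` is an eigenvector of it, with eigenvalue `-2k`. -/
lemma gaussMoment_grad_mul_grad {d k : ℕ} (hd : 1 ≤ d) {p : MvPolynomial (Fin d) ℂ}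
    (hp : p ∈ solidHarmonics d k) (q : MvPolynomial (Fin d) ℂ) :
    gaussMoment (∑ i, MvPolynomial.pderiv i p * MvPolynomial.pderiv i q) =
      2 * k * gaussMoment (p * q) := by
  rw [mem_solidHarmonics] at hp
  -- the divergence of `q ∇p`, where `Δp = 0`
  have h1 : ∑ i, MvPolynomial.pderiv i (MvPolynomial.pderiv i p * q) =
      ∑ i, MvPolynomial.pderiv i p * MvPolynomial.pderiv i q := by
    have : ∀ i, MvPolynomial.pderiv i (MvPolynomial.pderiv i p * q) =
        MvPolynomial.pderiv i p * MvPolynomial.pderiv i q +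
        MvPolynomial.pderiv i (MvPolynomial.pderiv i p) * q := fun i => by
      simp [Derivation.leibniz]
      ring
    simp_rw [this]
    rw [Finset.sum_add_distrib, ← Finset.sum_mul, hp.2, zero_mul, add_zero]
  -- Euler's identity for the homogeneous polynomial `p`
  have h2 : ∑ i, MvPolynomial.X i * (MvPolynomial.pderiv i p * q) =
      MvPolynomial.C (k : ℂ) * (p * q) := by
    have := hp.1.sum_X_mul_pderiv
    simp_rw [← mul_assoc]
    rw [← Finset.sum_mul, this]
    simp
  rw [← h1, gaussMoment_sum hd]
  simp_rw [gaussMoment_pderiv hd]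
  rw [← Finset.mul_sum, ← gaussMoment_sum hd, h2, gaussMoment_C_mul]
  ring

/-- Eigenvectors of a symmetric operator with different eigenvalues are orthogonal. -/
lemma gaussMoment_mul_eq_zero {d k m : ℕ} (hd : 1 ≤ d) (hkm : k ≠ m)
    {p q : MvPolynomial (Fin d) ℂ} (hp : p ∈ solidHarmonics d k) (hq : q ∈ solidHarmonics d m) :
    gaussMoment (p * q) = 0 := by
  have h1 := gaussMoment_grad_mul_grad hd hp q
  have h2 := gaussMoment_grad_mul_grad hd hq p
  simp_rw [mul_comm (MvPolynomial.pderiv _ q)] at h2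
  rw [mul_comm q p] at h2
  have h3 : (2 * ((k : ℂ) - m)) * gaussMoment (p * q) = 0 := by
    linear_combination h2 - h1
  refine (mul_eq_zero.1 h3).resolve_left ?_
  simpa [sub_eq_zero] using hkm

/-- The radial factor of the Gaussian moments of homogeneous polynomials of degree `n`. -/
def radialMoment (d n : ℕ) : ℝ :=
  ∫ r in Set.Ioi (0 : ℝ), r ^ (d - 1 + n) * Real.exp (-r ^ 2)

lemma radialMoment_pos (d n : ℕ) : 0 < radialMoment d n := by
  unfold radialMoment
  rw [setIntegral_pos_iff_support_of_nonneg_ae]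
  · have : Set.Ioi (0 : ℝ) ⊆
        Function.support (fun r : ℝ => r ^ (d - 1 + n) * Real.exp (-r ^ 2)) := by
      intro r hr
      have hr' : 0 < r := hr
      exact (by positivity : r ^ (d - 1 + n) * Real.exp (-r ^ 2) ≠ 0)
    rw [Set.inter_eq_right.2 this]
    simp
  · filter_upwards [ae_restrict_mem measurableSet_Ioi] with r hr
    have hr' : 0 < r := hr
    simp only [Pi.zero_apply]
    positivity
  · have h := (integrable_rpow_mul_exp_neg_mul_sq (b := 1) one_pos
      (s := ((d - 1 + n : ℕ) : ℝ)) (by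
        have : (0 : ℝ) ≤ ((d - 1 + n : ℕ) : ℝ) := Nat.cast_nonneg _
        linarith)).integrableOn (s := Set.Ioi 0)
    refine h.congr_fun (fun r _ => ?_) measurableSet_Ioi
    simp only [Real.rpow_natCast]
    ring_nf

instance {d : ℕ} : IsFiniteMeasure (sphMeasure d) := by
  unfold sphMeasure
  infer_instance

/-- Polar coordinates: the Gaussian moment of a homogeneous polynomial is a positive multiple of
its integral over the sphere. -/
lemma gaussMoment_eq_radialMoment_mul {d n : ℕ} (hd : 1 ≤ d) {p : MvPolynomial (Fin d) ℂ}
    (hp : p.IsHomogeneous n) :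
    gaussMoment p = (radialMoment d n : ℂ) * ∫ θ : Sph d, polyFun p θ ∂(sphMeasure d) := by
  have : Nonempty (Fin d) := ⟨⟨0, hd⟩⟩
  have : Nontrivial (EuclideanSpace ℝ (Fin d)) := inferInstance
  have hmp := Measure.measurePreserving_homeomorphUnitSphereProd
    (volume : Measure (EuclideanSpace ℝ (Fin d)))
  unfold gaussMoment
  calc ∫ x : EuclideanSpace ℝ (Fin d), polyFun p x * gaussian x
      = ∫ x : ({0}ᶜ : Set (EuclideanSpace ℝ (Fin d))), polyFun p x.1 * gaussian x.1
          ∂((volume : Measure _).comap Subtype.val) := by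
        rw [integral_subtype_comap (measurableSet_singleton _).compl
          fun x => polyFun p x * gaussian x, restrict_compl_singleton]
    _ = ∫ y : Sph d × Set.Ioi (0 : ℝ),
          polyFun p (y.1 : EuclideanSpace ℝ (Fin d)) *
            (((y.2 : ℝ) ^ n * Real.exp (-(y.2 : ℝ) ^ 2) : ℝ) : ℂ)
          ∂((sphMeasure d).prod (Measure.volumeIoiPow (d - 1))) := by
        have := hmp.integral_comp (Homeomorph.measurableEmbedding _)
          (g := fun y : Sph d × Set.Ioi (0 : ℝ) =>
            polyFun p (y.1 : EuclideanSpace ℝ (Fin d)) *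
            (((y.2 : ℝ) ^ n * Real.exp (-(y.2 : ℝ) ^ 2) : ℝ) : ℂ))
        rw [finrank_euclideanSpace, Fintype.card_fin] at this
        rw [sphMeasure, ← this]
        refine integral_congr_ae (ae_of_all _ fun x => ?_)
        have hx : (x : EuclideanSpace ℝ (Fin d)) ≠ 0 := x.2
        have hx' : ‖(x : EuclideanSpace ℝ (Fin d))‖ ≠ 0 := norm_ne_zero_iff.2 hx
        simp only [homeomorphUnitSphereProd_apply_fst_coe, homeomorphUnitSphereProd_apply_snd_coe]
        rw [polyFun_smul hp]
        simp only [gaussian]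
        push_cast
        have : (‖(x : EuclideanSpace ℝ (Fin d))‖ : ℂ) ≠ 0 := by exact_mod_cast hx'
        rw [inv_pow]
        field_simp
    _ = _ := by
        rw [integral_prod_mul (fun θ : Sph d => polyFun p (θ : EuclideanSpace ℝ (Fin d)))
          (fun r : Set.Ioi (0 : ℝ) => (((r : ℝ) ^ n * Real.exp (-(r : ℝ) ^ 2) : ℝ) : ℂ)), mul_comm]
        congr 1
        rw [integral_complex_ofReal]
        congr 1
        simp only [Measure.volumeIoiPow, ENNReal.ofReal]
        rw [integral_withDensity_eq_integral_smul (by fun_prop)]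
        simp only [radialMoment]
        rw [← integral_subtype_comap measurableSet_Ioi fun r : ℝ =>
          r ^ (d - 1 + n) * Real.exp (-r ^ 2)]
        congr 1
        ext r
        have hr : 0 < (r : ℝ) := r.2
        rw [NNReal.smul_def, Real.coe_toNNReal _ (pow_nonneg hr.le _), pow_add, smul_eq_mul]
        ring

lemma integrable_sph {d : ℕ} {E : Type*} [NormedAddCommGroup E] {f : Sph d → E}
    (hf : Continuous f) : Integrable f (sphMeasure d) := by
  have h := hf.continuousOn.integrableOn_compact (μ := sphMeasure d) isCompact_univ
  rwa [integrableOn_univ] at h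

lemma integral_sph_mul_eq_zero {d k m : ℕ} (hd : 1 ≤ d) (hkm : k ≠ m)
    {p q : MvPolynomial (Fin d) ℂ} (hp : p ∈ solidHarmonics d k) (hq : q ∈ solidHarmonics d m) :
    ∫ θ : Sph d, polyFun p θ * polyFun q θ ∂(sphMeasure d) = 0 := by
  have h1 := gaussMoment_mul_eq_zero hd hkm hp hq
  rw [gaussMoment_eq_radialMoment_mul hd
    ((mem_solidHarmonics.1 hp).1.mul (mem_solidHarmonics.1 hq).1)] at h1
  simp_rw [← polyFun_mul]
  refine (mul_eq_zero.1 h1).resolve_left ?_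
  exact_mod_cast (radialMoment_pos d _).ne'

namespace IsHarmonicBasis

variable {d : ℕ} {Y : (k : ℕ) → Fin (harmDim d k) → EuclideanSpace ℝ (Fin d) → ℝ}

lemma continuous_ofReal (hY : IsHarmonicBasis Y) (k : ℕ) (l : Fin (harmDim d k)) :
    Continuous (fun x => ((Y k l x : ℝ) : ℂ)) := by
  obtain ⟨p, -, h⟩ := hY.mem k l
  simp_rw [← h]
  exact continuous_polyFun p

lemma continuous (hY : IsHarmonicBasis Y) (k : ℕ) (l : Fin (harmDim d k)) :
    Continuous (Y k l) := by
  have := Complex.continuous_re.comp (hY.continuous_ofReal k l)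
  exact this

/-- The functions `Y k l` are orthonormal for all degrees together. -/
lemma integral_mul (hY : IsHarmonicBasis Y) (hd : 1 ≤ d) (p q : HarmIndex d) :
    ∫ θ : Sph d, ((Y p.1 p.2 θ : ℝ) : ℂ) * ((Y q.1 q.2 θ : ℝ) : ℂ) ∂(sphMeasure d) =
      if p = q then 1 else 0 := by
  obtain ⟨k, l⟩ := p
  obtain ⟨m, n⟩ := q
  by_cases hkm : k = m
  · subst hkm
    have := hY.orthonormal k l n
    simp_rw [← Complex.ofReal_mul]
    rw [integral_complex_ofReal, this]
    by_cases h : l = n <;> simp [h]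
  · obtain ⟨p, hp, hp'⟩ := hY.mem k l
    obtain ⟨q, hq, hq'⟩ := hY.mem m n
    have := integral_sph_mul_eq_zero hd hkm hp hq
    unfold polyFun at this
    simp_rw [hp', hq'] at this
    rw [this, if_neg]
    rintro ⟨⟩
    exact hkm rfl

/-- The `harmDim d k` orthonormal functions `Y k l` span the space of solid harmonics of
degree `k`. -/
lemma exists_eq_sum (hY : IsHarmonicBasis Y) {k : ℕ} {p : MvPolynomial (Fin d) ℂ}
    (hp : p ∈ solidHarmonics d k) :
    ∃ c : Fin (harmDim d k) → ℂ, ∀ x, polyFun p x = ∑ l, c l * ((Y k l x : ℝ) : ℂ) := by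
  choose P hP hPY using hY.mem k
  by_cases h0 : harmDim d k = 0
  · -- only the zero space or an infinite dimensional one has `finrank` zero
    have hfin : FiniteDimensional ℂ (solidHarmonics d k) := by
      have : FiniteDimensional ℂ (MvPolynomial.homogeneousSubmodule (Fin d) ℂ k) :=
        Module.Finite.iff_fg.2 (MvPolynomial.homogeneousSubmodule_fg _ _ k)
      exact Submodule.finiteDimensional_of_le (inf_le_left : solidHarmonics d k ≤ _)
    have hbot : solidHarmonics d k = ⊥ := Submodule.finrank_eq_zero.1 h0
    rw [hbot, Submodule.mem_bot] at hp
    refine ⟨0, fun x => ?_⟩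
    simp [hp, polyFun]
  · let v : Fin (harmDim d k) → solidHarmonics d k := fun l => ⟨P l, hP l⟩
    have hv : LinearIndependent ℂ v := by
      rw [Fintype.linearIndependent_iff]
      intro g hg m
      have h1 : ∑ l, g l • P l = 0 := by
        have := congrArg Subtype.val hg
        simpa [v] using this
      have h2 : ∀ x, ∑ l, g l * ((Y k l x : ℝ) : ℂ) = 0 := by
        intro x
        have := congrArg (MvPolynomial.eval (fun i => ((x i : ℝ) : ℂ))) h1
        simpa [MvPolynomial.smul_eval, hPY] using this
      have h3 : ∫ θ : Sph d, (∑ l, g l * ((Y k l θ : ℝ) : ℂ)) * ((Y k m θ : ℝ) : ℂ)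
          ∂(sphMeasure d) = g m := by
        simp_rw [Finset.sum_mul, mul_assoc]
        rw [integral_finsetSum]
        · have h4 : ∀ l, ∫ θ : Sph d, g l * (((Y k l θ : ℝ) : ℂ) * ((Y k m θ : ℝ) : ℂ))
              ∂(sphMeasure d) = if l = m then g l else 0 := by
            intro l
            simp_rw [← Complex.ofReal_mul]
            rw [integral_const_mul, integral_complex_ofReal, hY.orthonormal]
            split_ifs <;> simp
          simp [h4]
        · intro l _
          refine (integrable_sph ?_).const_mul _
          exact ((hY.continuous_ofReal k l).mul (hY.continuous_ofReal k m)).comp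
            continuous_subtype_val
      rw [← h3]
      simp [h2]
    have : Nonempty (Fin (harmDim d k)) := ⟨⟨0, Nat.pos_of_ne_zero h0⟩⟩
    let b := basisOfLinearIndependentOfCardEqFinrank hv (by rw [Fintype.card_fin]; rfl)
    refine ⟨fun l => b.repr ⟨p, hp⟩ l, fun x => ?_⟩
    have h1 := b.sum_repr ⟨p, hp⟩
    have h2 : ∑ l, b.repr ⟨p, hp⟩ l • P l = p := by
      have := congrArg Subtype.val h1
      simpa [b, v] using this
    conv_lhs => rw [← h2]
    simp [polyFun, MvPolynomial.smul_eval, hPY]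

end IsHarmonicBasis

/-! ### Rotation invariance and the size of spherical harmonics -/

/-- The polynomial `p ∘ R`, for a linear isometry `R` of `ℝᵈ`: the variable `xₐ` is replaced by
`⟪R⁻¹ eₐ, x⟫`. -/
def rot {d : ℕ} (R : EuclideanSpace ℝ (Fin d) ≃ₗᵢ[ℝ] EuclideanSpace ℝ (Fin d)) :
    MvPolynomial (Fin d) ℂ →ₐ[ℂ] MvPolynomial (Fin d) ℂ :=
  MvPolynomial.aeval fun a => ∑ i,
    MvPolynomial.C (((R.symm (EuclideanSpace.single a 1) i : ℝ)) : ℂ) * MvPolynomial.X i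

section rot

variable {d : ℕ} (R : EuclideanSpace ℝ (Fin d) ≃ₗᵢ[ℝ] EuclideanSpace ℝ (Fin d))

lemma polyFun_rot (p : MvPolynomial (Fin d) ℂ) (x : EuclideanSpace ℝ (Fin d)) :
    polyFun (rot R p) x = polyFun p (R x) := by
  unfold polyFun rot
  rw [MvPolynomial.aeval_def, MvPolynomial.eval_eval₂, MvPolynomial.eval,
    MvPolynomial.coe_eval₂Hom]
  congr 1
  · ext a
    simp
  · ext a
    have h : (R x) a = inner ℝ (R.symm (EuclideanSpace.single a 1)) x := by
      rw [← R.inner_map_map, R.apply_symm_apply]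
      simp [EuclideanSpace.inner_single_left]
    rw [h]
    simp [PiLp.inner_apply, mul_comm]

lemma gaussMoment_rot (p : MvPolynomial (Fin d) ℂ) : gaussMoment (rot R p) = gaussMoment p := by
  unfold gaussMoment
  rw [← R.measurePreserving.integral_comp R.toHomeomorph.measurableEmbedding
    (fun x => polyFun p x * gaussian x)]
  simp [polyFun_rot, gaussian]

lemma isHomogeneous_rot {k : ℕ} {p : MvPolynomial (Fin d) ℂ} (hp : p.IsHomogeneous k) :
    (rot R p).IsHomogeneous k := by
  have := hp.aeval (fun a => ∑ i,
    MvPolynomial.C (((R.symm (EuclideanSpace.single a 1) i : ℝ)) : ℂ) *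
      (MvPolynomial.X i : MvPolynomial (Fin d) ℂ)) (n := 1)
    (fun a => MvPolynomial.IsHomogeneous.sum _ _ _ fun i _ =>
      MvPolynomial.isHomogeneous_C_mul_X _ _)
  simpa [rot] using this

/-- The chain rule for `p ∘ R`. -/
lemma pderiv_rot (i : Fin d) (p : MvPolynomial (Fin d) ℂ) :
    MvPolynomial.pderiv i (rot R p) = ∑ a,
      MvPolynomial.C (((R.symm (EuclideanSpace.single a 1) i : ℝ)) : ℂ) *
        rot R (MvPolynomial.pderiv a p) := by
  classical
  induction p using MvPolynomial.induction_on with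
  | C c => simp [rot, ← MvPolynomial.algebraMap_eq]
  | add p q hp hq => simp only [map_add, hp, hq, mul_add, Finset.sum_add_distrib]
  | mul_X p j hp =>
    have hX : MvPolynomial.pderiv i (rot R (MvPolynomial.X j)) =
        MvPolynomial.C (((R.symm (EuclideanSpace.single j 1) i : ℝ)) : ℂ) := by
      simp [rot, MvPolynomial.pderiv_X, Pi.single_apply, Derivation.leibniz]
    rw [map_mul, Derivation.leibniz, hX, hp]
    simp only [Derivation.leibniz, smul_eq_mul, map_add, map_mul, MvPolynomial.pderiv_X, mul_add,
      Finset.sum_add_distrib, Finset.mul_sum]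
    congr 1
    · rw [Finset.sum_eq_single j]
      · simp; ring
      · intro a _ ha
        simp [Ne.symm ha]
      · simp
    · exact Finset.sum_congr rfl fun a _ => by ring

lemma rot_mem_solidHarmonics {k : ℕ} {p : MvPolynomial (Fin d) ℂ} (hp : p ∈ solidHarmonics d k) :
    rot R p ∈ solidHarmonics d k := by
  classical
  rw [mem_solidHarmonics] at hp ⊢
  refine ⟨isHomogeneous_rot R hp.1, ?_⟩
  have hR : ∀ a b : Fin d, ∑ i, (((R.symm (EuclideanSpace.single a 1) i : ℝ)) : ℂ) *
      (((R.symm (EuclideanSpace.single b 1) i : ℝ)) : ℂ) = if a = b then 1 else 0 := by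
    intro a b
    have h := R.symm.inner_map_map (EuclideanSpace.single a (1 : ℝ)) (EuclideanSpace.single b 1)
    rw [PiLp.inner_apply, EuclideanSpace.inner_single_left] at h
    have h2 : ∑ i, (R.symm (EuclideanSpace.single a 1) i) *
      (R.symm (EuclideanSpace.single b 1) i) = if a = b then 1 else 0 := by
      simp only [RCLike.inner_apply, conj_trivial] at h
      rw [← Finset.sum_congr rfl fun i _ => mul_comm _ _, h]
      simp
    have h3 := congrArg (fun t : ℝ => (t : ℂ)) h2
    simpa [apply_ite] using h3
  calc ∑ i, MvPolynomial.pderiv i (MvPolynomial.pderiv i (rot R p))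
      = ∑ i, ∑ a, ∑ b, MvPolynomial.C ((((R.symm (EuclideanSpace.single a 1) i : ℝ)) : ℂ) *
          (((R.symm (EuclideanSpace.single b 1) i : ℝ)) : ℂ)) *
            rot R (MvPolynomial.pderiv b (MvPolynomial.pderiv a p)) := by
        refine Finset.sum_congr rfl fun i _ => ?_
        rw [pderiv_rot, map_sum]
        refine Finset.sum_congr rfl fun a _ => ?_
        rw [MvPolynomial.pderiv_C_mul, pderiv_rot, Finset.mul_sum]
        refine Finset.sum_congr rfl fun b _ => ?_
        rw [MvPolynomial.C_mul, mul_assoc]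
    _ = ∑ a, ∑ b, MvPolynomial.C (∑ i, (((R.symm (EuclideanSpace.single a 1) i : ℝ)) : ℂ) *
          (((R.symm (EuclideanSpace.single b 1) i : ℝ)) : ℂ)) *
            rot R (MvPolynomial.pderiv b (MvPolynomial.pderiv a p)) := by
        rw [Finset.sum_comm]
        refine Finset.sum_congr rfl fun a _ => ?_
        rw [Finset.sum_comm]
        refine Finset.sum_congr rfl fun b _ => ?_
        rw [map_sum, Finset.sum_mul]
    _ = rot R (∑ a, MvPolynomial.pderiv a (MvPolynomial.pderiv a p)) := by
        simp_rw [hR]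
        rw [map_sum]
        refine Finset.sum_congr rfl fun a _ => ?_
        rw [Finset.sum_eq_single a]
        · simp
        · intro b _ hb
          simp [Ne.symm hb]
        · simp
    _ = 0 := by rw [hp.2, map_zero]

/-- The invariance of the surface measure under `R`, for homogeneous polynomials, read off from that
of the Gaussian moments. -/
lemma integral_sph_rot (hd : 1 ≤ d) {n : ℕ} {p : MvPolynomial (Fin d) ℂ}
    (hp : p.IsHomogeneous n) :
    ∫ θ : Sph d, polyFun p (R θ) ∂(sphMeasure d) = ∫ θ : Sph d, polyFun p θ ∂(sphMeasure d) := by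
  have h := gaussMoment_rot R p
  rw [gaussMoment_eq_radialMoment_mul hd hp,
    gaussMoment_eq_radialMoment_mul hd (isHomogeneous_rot R hp)] at h
  simp_rw [polyFun_rot] at h
  refine mul_left_cancel₀ ?_ h
  exact_mod_cast (radialMoment_pos d n).ne'

end rot

namespace IsHarmonicBasis

variable {d : ℕ} {Y : (k : ℕ) → Fin (harmDim d k) → EuclideanSpace ℝ (Fin d) → ℝ}

/-- The functions `Y k l` of one degree are transformed by an orthogonal matrix when the sphere is
rotated. -/
lemma sum_sq_rot (hY : IsHarmonicBasis Y) (hd : 1 ≤ d) (k : ℕ)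
    (R : EuclideanSpace ℝ (Fin d) ≃ₗᵢ[ℝ] EuclideanSpace ℝ (Fin d)) (x) :
    ∑ l, Y k l (R x) ^ 2 = ∑ l, Y k l x ^ 2 := by
  choose P hP hPY using hY.mem k
  -- real parts suffice, as the functions `Y k l` are real
  have hU : ∀ l, ∃ u : Fin (harmDim d k) → ℝ, ∀ x, Y k l (R x) = ∑ m, u m * Y k m x := by
    intro l
    obtain ⟨c, hc⟩ := hY.exists_eq_sum (rot_mem_solidHarmonics R (hP l))
    refine ⟨fun m => (c m).re, fun x => ?_⟩
    have h := hc x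
    rw [polyFun_rot, polyFun, hPY] at h
    have := congrArg Complex.re h
    simpa using this
  choose U hU using hU
  have horth : ∀ l l', ∑ m, U l m * U l' m = if l = l' then 1 else 0 := by
    intro l l'
    have h1 : ∫ θ : Sph d, Y k l (R θ) * Y k l' (R θ) ∂(sphMeasure d) =
        if l = l' then 1 else 0 := by
      rw [← hY.orthonormal k l l']
      have h := integral_sph_rot R hd
        ((mem_solidHarmonics.1 (hP l)).1.mul (mem_solidHarmonics.1 (hP l')).1)
      simp_rw [polyFun_mul] at h
      unfold polyFun at h
      simp_rw [hPY, ← Complex.ofReal_mul, integral_complex_ofReal] at h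
      exact_mod_cast h
    rw [← h1]
    simp_rw [hU, Finset.sum_mul_sum]
    have hint : ∀ m m', Integrable (fun θ : Sph d => U l m * Y k m θ * (U l' m' * Y k m' θ))
        (sphMeasure d) := fun m m' => integrable_sph <|
      (((hY.continuous k m).comp continuous_subtype_val).const_mul _).mul
        (((hY.continuous k m').comp continuous_subtype_val).const_mul _)
    rw [integral_finsetSum _ fun m _ => integrable_finsetSum _ fun m' _ => hint m m']
    refine Finset.sum_congr rfl fun m _ => ?_
    rw [integral_finsetSum _ fun m' _ => hint m m']
    have hterm : ∀ m', ∫ θ : Sph d, U l m * Y k m θ * (U l' m' * Y k m' θ) ∂(sphMeasure d) =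
        if m = m' then U l m * U l' m' else 0 := by
      intro m'
      rw [← mul_boole, ← hY.orthonormal k m m', ← integral_const_mul]
      exact integral_congr_ae (ae_of_all _ fun θ => by ring)
    simp [hterm]
  let M : Matrix (Fin (harmDim d k)) (Fin (harmDim d k)) ℝ := Matrix.of U
  have hM : M * M.transpose = 1 := by
    ext l l'
    simpa [M, Matrix.mul_apply, Matrix.one_apply] using horth l l'
  have hM' : M.transpose * M = 1 := mul_eq_one_comm.1 hM
  have hv : (fun l => Y k l (R x)) = M.mulVec (fun l => Y k l x) := by
    ext l
    simp [M, Matrix.mulVec, dotProduct, hU]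
  have h1 : ∑ l, Y k l (R x) ^ 2 = dotProduct (fun l => Y k l (R x)) (fun l => Y k l (R x)) := by
    simp [dotProduct, sq]
  rw [h1, hv, Matrix.dotProduct_mulVec, Matrix.vecMul_mulVec, ← Matrix.dotProduct_mulVec,
    hM', Matrix.one_mulVec]
  simp [dotProduct, sq]

/-- The addition theorem on the diagonal: `∑ₗ Y k l θ ^ 2` does not depend on `θ`, since a
reflection moves any point of the sphere to any other; its value follows by integration. -/
lemma sum_sq_eq (hY : IsHarmonicBasis Y) (hd : 1 ≤ d) (k : ℕ) (θ : Sph d) :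
    (∑ l, Y k l θ ^ 2) * (sphMeasure d).real Set.univ = harmDim d k := by
  have hconst : ∀ θ' : Sph d, ∑ l, Y k l θ' ^ 2 = ∑ l, Y k l θ ^ 2 := by
    intro θ'
    have hn : ‖(θ : EuclideanSpace ℝ (Fin d))‖ = ‖(θ' : EuclideanSpace ℝ (Fin d))‖ := by simp
    have := hY.sum_sq_rot hd k (Submodule.reflection
      (Submodule.span ℝ {(θ : EuclideanSpace ℝ (Fin d)) - θ'})ᗮ) θ
    rwa [Submodule.reflection_sub hn] at this
  have h1 : ∫ θ' : Sph d, ∑ l, Y k l θ' ^ 2 ∂(sphMeasure d) = harmDim d k := by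
    have hint : ∀ l, Integrable (fun θ' : Sph d => Y k l θ' ^ 2) (sphMeasure d) := fun l =>
      integrable_sph (((hY.continuous k l).comp continuous_subtype_val).pow 2)
    rw [integral_finsetSum _ fun l _ => hint l]
    simp_rw [sq, hY.orthonormal]
    simp
  simp_rw [hconst] at h1
  rw [integral_const, smul_eq_mul, mul_comm] at h1
  exact h1

end IsHarmonicBasis

lemma sphMeasure_univ_pos {d : ℕ} (hd : 1 ≤ d) : 0 < (sphMeasure d).real Set.univ := by
  have : Nonempty (Fin d) := ⟨⟨0, hd⟩⟩
  have : Nontrivial (EuclideanSpace ℝ (Fin d)) := inferInstance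
  have : sphMeasure d ≠ 0 := Measure.toSphere_ne_zero _
  have : NeZero (sphMeasure d) := ⟨this⟩
  exact measureReal_univ_pos

/-- There are at most `(k + 1) ^ d` monomials of degree `k`. -/
lemma harmDim_le (d k : ℕ) : harmDim d k ≤ (k + 1) ^ d := by
  classical
  have hfg : FiniteDimensional ℂ (MvPolynomial.homogeneousSubmodule (Fin d) ℂ k) :=
    Module.Finite.iff_fg.2 (MvPolynomial.homogeneousSubmodule_fg _ _ k)
  have h1 : harmDim d k ≤ Module.finrank ℂ (MvPolynomial.homogeneousSubmodule (Fin d) ℂ k) :=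
    Submodule.finrank_mono inf_le_left
  let g : (Fin d → Fin (k + 1)) → MvPolynomial (Fin d) ℂ := fun s =>
    MvPolynomial.monomial (Finsupp.equivFunOnFinite.symm fun i => (s i : ℕ)) 1
  have h2 : MvPolynomial.homogeneousSubmodule (Fin d) ℂ k ≤ Submodule.span ℂ (Set.range g) := by
    intro p hp
    rw [MvPolynomial.mem_homogeneousSubmodule] at hp
    rw [p.as_sum]
    refine Submodule.sum_mem _ fun s hs => ?_
    have hs' : ∑ i ∈ s.support, s i = k := (hp.degree_eq_sum_deg_support hs).symm
    have hle : ∀ i, s i < k + 1 := by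
      intro i
      by_cases hi : i ∈ s.support
      · have := Finset.single_le_sum (f := fun i => s i) (fun _ _ => Nat.zero_le _) hi
        omega
      · rw [Finsupp.notMem_support_iff.1 hi]
        omega
    have : MvPolynomial.monomial s (MvPolynomial.coeff s p) =
        MvPolynomial.coeff s p • g (fun i => ⟨s i, hle i⟩) := by
      rw [MvPolynomial.smul_monomial]
      simp only [smul_eq_mul, mul_one]
      congr 2
      ext i
      rfl
    rw [this]
    exact Submodule.smul_mem _ _ (Submodule.subset_span ⟨_, rfl⟩)
  have : FiniteDimensional ℂ (Submodule.span ℂ (Set.range g)) :=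
    FiniteDimensional.span_of_finite ℂ (Set.finite_range g)
  have h3 := Submodule.finrank_mono h2
  have h4 := finrank_range_le_card (R := ℂ) g
  have h5 : Fintype.card (Fin d → Fin (k + 1)) = (k + 1) ^ d := by simp
  unfold Set.finrank at h4
  omega

/-- A bound for the spherical harmonics of degree `k` which grows polynomially in `k`. -/
def harmBound (d k : ℕ) : ℝ := Real.sqrt (harmDim d k / (sphMeasure d).real Set.univ)

lemma harmBound_nonneg (d k : ℕ) : 0 ≤ harmBound d k := Real.sqrt_nonneg _

lemma harmBound_sq (d k : ℕ) :
    harmBound d k ^ 2 = harmDim d k / (sphMeasure d).real Set.univ :=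
  Real.sq_sqrt (by positivity)

lemma IsHarmonicBasis.abs_le {d : ℕ}
    {Y : (k : ℕ) → Fin (harmDim d k) → EuclideanSpace ℝ (Fin d) → ℝ}
    (hY : IsHarmonicBasis Y) (hd : 1 ≤ d) (k : ℕ) (l : Fin (harmDim d k)) (θ : Sph d) :
    |Y k l θ| ≤ harmBound d k := by
  refine Real.abs_le_sqrt ?_
  rw [le_div_iff₀ (sphMeasure_univ_pos hd), ← hY.sum_sq_eq hd k θ]
  gcongr
  exact Finset.single_le_sum (f := fun l => Y k l θ ^ 2) (fun _ _ => sq_nonneg _)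
    (Finset.mem_univ l)

/-- The series which dominates the kernel: the factor `L⁻²ᵏ` beats the polynomial growth of the
dimensions. -/
lemma summable_harmBound_sq {d : ℕ} {L : ℝ} (hL : 1 < L) :
    Summable fun p : HarmIndex d => (L ^ (2 * p.1))⁻¹ * harmBound d p.1 ^ 2 := by
  have hL0 : 0 < L := by linarith
  rw [summable_sigma_of_nonneg (fun p => by positivity)]
  refine ⟨fun k => (hasSum_fintype _).summable, ?_⟩
  simp only [tsum_fintype, Finset.sum_const, Finset.card_univ, Fintype.card_fin, nsmul_eq_mul,
    harmBound_sq]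
  have hr : ‖((L ^ 2)⁻¹ : ℝ)‖ < 1 := by
    rw [Real.norm_of_nonneg (by positivity)]
    exact inv_lt_one_of_one_lt₀ (one_lt_pow₀ hL two_ne_zero)
  have hs := ((summable_pow_mul_geometric_of_norm_lt_one (2 * d) hr).comp_injective
    (add_left_injective 1)).mul_left (L ^ 2 / (sphMeasure d).real Set.univ)
  refine hs.of_nonneg_of_le (fun k => by positivity) fun k => ?_
  have h1 : (harmDim d k : ℝ) ≤ ((k : ℝ) + 1) ^ d := by exact_mod_cast harmDim_le d k
  calc (harmDim d k : ℝ) * ((L ^ (2 * k))⁻¹ * (harmDim d k / (sphMeasure d).real Set.univ))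
      = (harmDim d k : ℝ) ^ 2 * (L ^ (2 * k))⁻¹ / (sphMeasure d).real Set.univ := by ring
    _ ≤ (((k : ℝ) + 1) ^ d) ^ 2 * (L ^ (2 * k))⁻¹ / (sphMeasure d).real Set.univ := by gcongr
    _ = _ := by
      simp only [Function.comp_apply]
      push_cast
      have : (L ^ 2) ^ (k + 1) = L ^ 2 * L ^ (2 * k) := by ring
      rw [inv_pow, this, mul_comm 2 d, pow_mul (_ + 1) d 2]
      field_simp

/-! ### Laurent series on an annulus -/

/-- The mean `(1/2π) ∫ z⁻ⁿ f(z) dφ` over the circle `z = r e^{iφ}`. For `f` analytic on an annulus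
it is the `n`-th Laurent coefficient of `f`, whichever circle of the annulus is taken. -/
def laurentCoeff (f : ℂ → ℂ) (r : ℝ) (n : ℤ) : ℂ :=
  Real.circleAverage (fun z => z ^ (-n) * f z) 0 r

instance : Fact (0 < 2 * Real.pi) := ⟨Real.two_pi_pos⟩

lemma fourier_eq_exp (n : ℤ) (φ : ℝ) :
    fourier n (φ : AddCircle (2 * Real.pi)) = Complex.exp (φ * Complex.I) ^ n := by
  rw [fourier_coe_apply, ← Complex.exp_int_mul]
  congr 1
  have : (Real.pi : ℂ) ≠ 0 := by exact_mod_cast Real.pi_ne_zero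
  push_cast
  field_simp

/-- The function `φ ↦ f(r e^{iφ})` on `ℝ / 2πℤ`. -/
def onCircle (f : ℂ → ℂ) {r : ℝ} (hr : 0 < r) (hf : ContinuousOn f (Metric.sphere 0 r)) :
    C(AddCircle (2 * Real.pi), ℂ) where
  toFun x := f (r * fourier 1 x)
  continuous_toFun := by
    refine hf.comp_continuous (by fun_prop) fun x => ?_
    rw [mem_sphere_zero_iff_norm, norm_mul, Complex.norm_real, Real.norm_of_nonneg hr.le,
      fourier_apply, Circle.norm_coe, mul_one]

lemma onCircle_coe (f : ℂ → ℂ) {r : ℝ} (hr : 0 < r) (hf : ContinuousOn f (Metric.sphere 0 r))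
    (φ : ℝ) : onCircle f hr hf (φ : AddCircle (2 * Real.pi)) = f (circleMap 0 r φ) := by
  change f (r * fourier 1 (φ : AddCircle (2 * Real.pi))) = _
  rw [fourier_eq_exp]
  simp [circleMap]

section Circle

variable {f : ℂ → ℂ} {r : ℝ} (hr : 0 < r) (hf : ContinuousOn f (Metric.sphere 0 r))
include hr hf

lemma fourierCoeff_onCircle (n : ℤ) :
    fourierCoeff (onCircle f hr hf) n = laurentCoeff f r n * (r : ℂ) ^ n := by
  rw [fourierCoeff_eq_intervalIntegral _ n 0, laurentCoeff, Real.circleAverage_def, zero_add,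
    one_div, smul_mul_assoc, ← intervalIntegral.integral_mul_const]
  congr 1
  refine intervalIntegral.integral_congr fun φ _ => ?_
  have hr' : (r : ℂ) ≠ 0 := by exact_mod_cast hr.ne'
  simp only [onCircle_coe, fourier_eq_exp, smul_eq_mul, circleMap, zero_add, mul_zpow]
  rw [zpow_neg (r : ℂ)]
  have : (r : ℂ) ^ n ≠ 0 := zpow_ne_zero _ hr'
  field_simp

/-- Parseval's identity on a circle. -/
lemma hasSum_norm_laurentCoeff_sq :
    HasSum (fun n : ℤ => ‖laurentCoeff f r n‖ ^ 2 * r ^ (2 * n)) (meanSq f r) := by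
  have h := hasSum_sq_fourierCoeff
    (ContinuousMap.toLp 2 AddCircle.haarAddCircle ℂ (onCircle f hr hf))
  simp_rw [fourierCoeff_toLp, fourierCoeff_onCircle hr hf] at h
  convert h using 1
  · ext n
    rw [norm_mul, mul_pow, norm_zpow, Complex.norm_real, Real.norm_of_nonneg hr.le, mul_comm 2 n,
      zpow_mul]
    norm_cast
  · have h1 : ∫ t : AddCircle (2 * Real.pi),
        ‖(ContinuousMap.toLp 2 AddCircle.haarAddCircle ℂ (onCircle f hr hf)) t‖ ^ 2
          ∂AddCircle.haarAddCircle =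
        ∫ t : AddCircle (2 * Real.pi), ‖onCircle f hr hf t‖ ^ 2 ∂AddCircle.haarAddCircle := by
      refine integral_congr_ae ?_
      filter_upwards [ContinuousMap.coeFn_toLp (p := 2) (𝕜 := ℂ) AddCircle.haarAddCircle
        (onCircle f hr hf)] with t ht
      rw [ht]
    rw [h1, AddCircle.integral_haarAddCircle, ← AddCircle.intervalIntegral_preimage _ 0, zero_add,
      meanSq, Real.circleAverage_def]
    simp_rw [onCircle_coe]

lemma hasSum_laurentCoeff_mul_zpow
    (hs : Summable fun n : ℤ => ‖laurentCoeff f r n‖ * r ^ n) {z : ℂ} (hz : ‖z‖ = r) :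
    HasSum (fun n : ℤ => laurentCoeff f r n * z ^ n) (f z) := by
  have hs' : Summable (fourierCoeff (onCircle f hr hf)) := by
    refine Summable.of_norm (hs.congr fun n => ?_)
    rw [fourierCoeff_onCircle hr hf, norm_mul, norm_zpow, Complex.norm_real,
      Real.norm_of_nonneg hr.le]
  have h := has_pointwise_sum_fourier_series_of_summable hs' (z.arg : AddCircle (2 * Real.pi))
  have hz' : (r : ℂ) * Complex.exp (z.arg * Complex.I) = z := by
    rw [← hz]
    exact Complex.norm_mul_exp_arg_mul_I z
  rw [onCircle_coe, circleMap, zero_add, hz'] at h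
  convert h using 1
  ext n
  rw [fourierCoeff_onCircle hr hf, fourier_eq_exp, smul_eq_mul, mul_assoc, ← mul_zpow, hz']

end Circle

lemma sphere_subset_annulus {a b r : ℝ} (hr : r ∈ Set.Ioo a b) :
    Metric.sphere (0 : ℂ) r ⊆ annulus a b := fun z hz => by
  rw [mem_sphere_zero_iff_norm] at hz
  exact ⟨hz ▸ hr.1, hz ▸ hr.2⟩

lemma isOpen_annulus (a b : ℝ) : IsOpen (annulus a b) :=
  (isOpen_lt continuous_const continuous_norm).inter (isOpen_lt continuous_norm continuous_const)

/-- By Cauchy's theorem on the annulus between the two circles. -/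
lemma laurentCoeff_eq {a b : ℝ} (ha : 0 < a) {f : ℂ → ℂ}
    (hf : DifferentiableOn ℂ f (annulus a b)) {r s : ℝ} (hr : r ∈ Set.Ioo a b)
    (hs : s ∈ Set.Ioo a b) (n : ℤ) : laurentCoeff f r n = laurentCoeff f s n := by
  wlog h : s ≤ r generalizing r s
  · exact (this hs hr (le_of_not_ge h)).symm
  have hs0 : 0 < s := ha.trans hs.1
  have hr0 : 0 < r := ha.trans hr.1
  have hd : ∀ z ∈ annulus a b, DifferentiableAt ℂ (fun z => z ^ (-n) * f z) z := by
    intro z hz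
    have hz0 : z ≠ 0 := norm_pos_iff.1 (ha.trans hz.1)
    exact (differentiableAt_zpow.2 (Or.inl hz0)).mul
      (hf.differentiableAt ((isOpen_annulus a b).mem_nhds hz))
  unfold laurentCoeff
  rw [Real.circleAverage_eq_circleIntegral hr0.ne', Real.circleAverage_eq_circleIntegral hs0.ne']
  congr 1
  refine Complex.circleIntegral_sub_center_inv_smul_eq_of_differentiable_on_annulus_off_countable
    hs0 h Set.countable_empty (fun z hz => ?_) fun z hz => ?_
  · refine (hd z ⟨?_, ?_⟩).continuousAt.continuousWithinAt
    · have := hz.2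
      simp only [Metric.mem_ball, dist_zero_right, not_lt] at this
      exact hs.1.trans_le this
    · have := hz.1
      simp only [Metric.mem_closedBall, dist_zero_right] at this
      exact this.trans_lt hr.2
  · refine hd z ⟨?_, ?_⟩
    · have := hz.1.2
      simp only [Metric.mem_closedBall, dist_zero_right, not_le] at this
      exact hs.1.trans this
    · have := hz.1.1
      simp only [Metric.mem_ball, dist_zero_right] at this
      exact this.trans hr.2

/-! ### The Hardy space of an annulus in terms of Laurent coefficients -/

/-- The `n`-th Laurent coefficient of a function on the annulus `a < |z| < b`, computed on the
circle in the middle. -/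
def annCoeff (a b : ℝ) (f : ℂ → ℂ) (n : ℤ) : ℂ := laurentCoeff f ((a + b) / 2) n

lemma mid_mem {a b : ℝ} (hab : a < b) : (a + b) / 2 ∈ Set.Ioo a b := ⟨by linarith, by linarith⟩

lemma zpow_le_add {a b r : ℝ} (ha : 0 < a) (hr : r ∈ Set.Icc a b) (n : ℤ) :
    r ^ n ≤ a ^ n + b ^ n := by
  have hr0 : 0 < r := ha.trans_le hr.1
  have hb0 : 0 < b := hr0.trans_le hr.2
  rcases le_or_gt 0 n with hn | hn
  · have := zpow_le_zpow_left₀ hn hr0.le hr.2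
    have := zpow_pos ha n
    linarith
  · have h1 := zpow_le_zpow_left₀ (n := -n) (by omega) ha.le hr.1
    have h2 : r ^ n ≤ a ^ n := by
      rw [zpow_neg, zpow_neg] at h1
      exact (inv_le_inv₀ (zpow_pos ha n) (zpow_pos hr0 n)).1 h1
    have := zpow_pos hb0 n
    linarith

/-- The majorant of `rⁿ` relative to the sizes of `zⁿ` on the two boundary circles. -/
def radialWeight (a b r : ℝ) (n : ℤ) : ℝ := if 0 ≤ n then (r / b) ^ n else (r / a) ^ n

lemma radialWeight_nonneg {a b r : ℝ} (ha : 0 < a) (hr : r ∈ Set.Ioo a b) (n : ℤ) :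
    0 ≤ radialWeight a b r n := by
  have hr0 : 0 < r := ha.trans hr.1
  have hb0 : 0 < b := hr0.trans hr.2
  unfold radialWeight
  split_ifs <;> positivity

lemma summable_radialWeight {a b r : ℝ} (ha : 0 < a) (hr : r ∈ Set.Ioo a b) :
    Summable (radialWeight a b r) := by
  have hr0 : 0 < r := ha.trans hr.1
  have hb0 : 0 < b := hr0.trans hr.2
  refine Summable.of_nat_of_neg_add_one ?_ ?_
  · have := summable_geometric_of_lt_one (r := r / b) (by positivity) ((div_lt_one hb0).2 hr.2)
    refine this.congr fun n => ?_
    simp [radialWeight]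
  · have := (summable_geometric_of_lt_one (r := a / r) (by positivity)
      ((div_lt_one hr0).2 hr.1)).comp_injective (add_left_injective 1)
    refine this.congr fun n => ?_
    have hn : ¬ (0 : ℤ) ≤ -((n : ℤ) + 1) := by omega
    rw [radialWeight, if_neg hn, zpow_neg, ← inv_zpow, inv_div]
    norm_cast

namespace MemHardy

variable {a b : ℝ} {f : ℂ → ℂ}

lemma continuousOn_sphere (hf : MemHardy a b f) {r : ℝ} (hr : r ∈ Set.Ioo a b) :
    ContinuousOn f (Metric.sphere 0 r) :=
  hf.1.continuousOn.mono (sphere_subset_annulus hr)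

lemma hasSum_meanSq (hf : MemHardy a b f) (ha : 0 < a) (hab : a < b) {r : ℝ}
    (hr : r ∈ Set.Ioo a b) :
    HasSum (fun n : ℤ => ‖annCoeff a b f n‖ ^ 2 * r ^ (2 * n)) (meanSq f r) := by
  have h := hasSum_norm_laurentCoeff_sq (ha.trans hr.1) (hf.continuousOn_sphere hr)
  simpa only [annCoeff, laurentCoeff_eq ha hf.1 hr (mid_mem hab)] using h

/-- The sums over an interior circle are bounded by the supremum of the means, so the partial sums on
a boundary circle are. -/
lemma summable_endpoint (hf : MemHardy a b f) (ha : 0 < a) (hab : a < b) {s : ℝ}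
    (hs : s ∈ Set.Icc a b) : Summable fun n : ℤ => ‖annCoeff a b f n‖ ^ 2 * s ^ (2 * n) := by
  obtain ⟨B, hB⟩ := hf.2
  have hs0 : 0 < s := ha.trans_le hs.1
  refine summable_of_sum_le (c := B) (fun n => by positivity) fun u => ?_
  have hcl : s ∈ closure (Set.Ioo a b) := by rwa [closure_Ioo hab.ne]
  have : (𝓝[Set.Ioo a b] s).NeBot := mem_closure_iff_nhdsWithin_neBot.1 hcl
  have hlim : Tendsto (fun r : ℝ => ∑ n ∈ u, ‖annCoeff a b f n‖ ^ 2 * r ^ (2 * n))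
      (𝓝[Set.Ioo a b] s) (𝓝 (∑ n ∈ u, ‖annCoeff a b f n‖ ^ 2 * s ^ (2 * n))) := by
    refine tendsto_finsetSum _ fun n _ => Tendsto.mono_left ?_ nhdsWithin_le_nhds
    exact (continuousAt_zpow₀ s _ (Or.inl hs0.ne')).tendsto.const_mul _
  refine le_of_tendsto hlim ?_
  filter_upwards [self_mem_nhdsWithin] with r hr
  have hr0 : 0 < r := ha.trans hr.1
  refine (sum_le_hasSum u (fun n _ => by positivity) (hf.hasSum_meanSq ha hab hr)).trans ?_
  exact hB ⟨r, hr, rfl⟩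

lemma summable_norm_sq (hf : MemHardy a b f) (ha : 0 < a) (hab : a < b) :
    Summable fun n : ℤ => ‖annCoeff a b f n‖ ^ 2 * (a ^ (2 * n) + b ^ (2 * n)) := by
  simp_rw [mul_add]
  exact (hf.summable_endpoint ha hab ⟨le_rfl, hab.le⟩).add
    (hf.summable_endpoint ha hab ⟨hab.le, le_rfl⟩)

lemma tendsto_meanSq (hf : MemHardy a b f) (ha : 0 < a) (hab : a < b) {s : ℝ}
    (hs : s ∈ Set.Icc a b) : Tendsto (meanSq f) (𝓝[Set.Ioo a b] s)
      (𝓝 (∑' n : ℤ, ‖annCoeff a b f n‖ ^ 2 * s ^ (2 * n))) := by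
  have hs0 : 0 < s := ha.trans_le hs.1
  have h := tendsto_tsum_of_dominated_convergence (𝓕 := 𝓝[Set.Ioo a b] s)
    (f := fun r n => ‖annCoeff a b f n‖ ^ 2 * r ^ (2 * n))
    (g := fun n => ‖annCoeff a b f n‖ ^ 2 * s ^ (2 * n)) (hf.summable_norm_sq ha hab)
    (fun n => ((continuousAt_zpow₀ s _ (Or.inl hs0.ne')).tendsto.const_mul _).mono_left
      nhdsWithin_le_nhds) ?_
  · refine h.congr' ?_
    filter_upwards [self_mem_nhdsWithin] with r hr
    exact (hf.hasSum_meanSq ha hab hr).tsum_eq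
  · filter_upwards [self_mem_nhdsWithin] with r hr n
    have hr0 : 0 < r := ha.trans hr.1
    rw [Real.norm_of_nonneg (by positivity)]
    gcongr
    exact zpow_le_add ha ⟨hr.1.le, hr.2.le⟩ _

/-- The norm of the Hardy space is a weighted `ℓ²` norm of the Laurent coefficients. -/
lemma hasSum_hardyNormSq (hf : MemHardy a b f) (ha : 0 < a) (hab : a < b) :
    HasSum (fun n : ℤ => ‖annCoeff a b f n‖ ^ 2 * (a ^ (2 * n) + b ^ (2 * n)))
      (hardyNormSq a b f) := by
  have h1 := hf.tendsto_meanSq ha hab ⟨le_rfl, hab.le⟩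
  have h2 := hf.tendsto_meanSq ha hab ⟨hab.le, le_rfl⟩
  rw [nhdsWithin_Ioo_eq_nhdsGT hab] at h1
  rw [nhdsWithin_Ioo_eq_nhdsLT hab] at h2
  rw [hardyNormSq, h1.limUnder_eq, h2.limUnder_eq]
  simp_rw [mul_add]
  exact (hf.summable_endpoint ha hab ⟨le_rfl, hab.le⟩).hasSum.add
    (hf.summable_endpoint ha hab ⟨hab.le, le_rfl⟩).hasSum

lemma hardyNormSq_nonneg (hf : MemHardy a b f) (ha : 0 < a) (hab : a < b) :
    0 ≤ hardyNormSq a b f :=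
  (hf.hasSum_hardyNormSq ha hab).nonneg fun n => by
    have := ha.trans hab
    positivity

lemma norm_annCoeff_sq_le (hf : MemHardy a b f) (ha : 0 < a) (hab : a < b) (n : ℤ) :
    ‖annCoeff a b f n‖ ^ 2 * (a ^ (2 * n) + b ^ (2 * n)) ≤ hardyNormSq a b f :=
  le_hasSum (hf.hasSum_hardyNormSq ha hab) n fun m _ => by
    have := ha.trans hab
    positivity

lemma norm_annCoeff_mul_zpow_le (hf : MemHardy a b f) (ha : 0 < a) (hab : a < b) {r : ℝ}
    (hr : r ∈ Set.Ioo a b) (n : ℤ) :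
    ‖annCoeff a b f n‖ * r ^ n ≤ Real.sqrt (hardyNormSq a b f) * radialWeight a b r n := by
  have hb : 0 < b := ha.trans hab
  have hr0 : 0 < r := ha.trans hr.1
  have h := hf.norm_annCoeff_sq_le ha hab n
  -- used with `s = b` for `n ≥ 0` and with `s = a` for `n < 0`
  have hbound : ∀ s : ℝ, 0 < s → s ^ (2 * n) ≤ a ^ (2 * n) + b ^ (2 * n) →
      ‖annCoeff a b f n‖ * r ^ n ≤ Real.sqrt (hardyNormSq a b f) * (r / s) ^ n := by
    intro s hs hle
    have h1 : ‖annCoeff a b f n‖ * s ^ n ≤ Real.sqrt (hardyNormSq a b f) := by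
      refine Real.le_sqrt_of_sq_le (le_trans ?_ h)
      rw [mul_pow, ← zpow_natCast (s ^ n), ← zpow_mul, mul_comm n]
      push_cast
      gcongr
    have h2 : r ^ n = s ^ n * (r / s) ^ n := by
      rw [← mul_zpow, mul_div_cancel₀ _ hs.ne']
    rw [h2, ← mul_assoc]
    gcongr
  unfold radialWeight
  split_ifs
  · exact hbound b hb (by have := zpow_pos ha (2 * n); linarith)
  · exact hbound a ha (by have := zpow_pos hb (2 * n); linarith)

lemma hasSum_annCoeff (hf : MemHardy a b f) (ha : 0 < a) (hab : a < b) {z : ℂ}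
    (hz : z ∈ annulus a b) : HasSum (fun n : ℤ => annCoeff a b f n * z ^ n) (f z) := by
  have hz' : ‖z‖ ∈ Set.Ioo a b := hz
  have hz0 : 0 < ‖z‖ := ha.trans hz.1
  have he := fun n => laurentCoeff_eq ha hf.1 hz' (mid_mem hab) n
  have h := hasSum_laurentCoeff_mul_zpow hz0 (hf.continuousOn_sphere hz') ?_ rfl
  · simpa only [annCoeff, he] using h
  · refine ((summable_radialWeight ha hz').mul_left (Real.sqrt (hardyNormSq a b f))).of_nonneg_of_le
      (fun n => by positivity) fun n => ?_
    rw [he]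
    exact hf.norm_annCoeff_mul_zpow_le ha hab hz' n

lemma sub {g : ℂ → ℂ} (hf : MemHardy a b f) (hg : MemHardy a b g) (ha : 0 < a) :
    MemHardy a b (f - g) := by
  refine ⟨hf.1.sub hg.1, ?_⟩
  obtain ⟨A, hA⟩ := hf.2
  obtain ⟨B, hB⟩ := hg.2
  refine ⟨2 * A + 2 * B, ?_⟩
  rintro _ ⟨r, hr, rfl⟩
  have hr0 : 0 < r := ha.trans hr.1
  have cf := hf.continuousOn_sphere hr
  have cg := hg.continuousOn_sphere hr
  have if2 : CircleIntegrable ((2 : ℝ) • fun z => ‖f z‖ ^ 2) 0 r :=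
    ((cf.norm.pow 2).const_smul (2 : ℝ)).circleIntegrable hr0.le
  have ig2 : CircleIntegrable ((2 : ℝ) • fun z => ‖g z‖ ^ 2) 0 r :=
    ((cg.norm.pow 2).const_smul (2 : ℝ)).circleIntegrable hr0.le
  calc meanSq (f - g) r
      ≤ Real.circleAverage (((2 : ℝ) • fun z => ‖f z‖ ^ 2) + (2 : ℝ) • fun z => ‖g z‖ ^ 2) 0 r := by
        refine Real.circleAverage_mono (((cf.sub cg).norm.pow 2).circleIntegrable hr0.le)
          (if2.add ig2) fun z _ => ?_
        simp only [Pi.sub_apply, Pi.add_apply, Pi.smul_apply, smul_eq_mul]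
        have h1 := norm_sub_le (f z) (g z)
        have h2 := norm_nonneg (f z - g z)
        nlinarith [sq_nonneg (‖f z‖ - ‖g z‖)]
    _ = 2 * meanSq f r + 2 * meanSq g r := by
        rw [Real.circleAverage_add if2 ig2, Real.circleAverage_smul, Real.circleAverage_smul]
        rfl
    _ ≤ 2 * A + 2 * B := by
        have := hA ⟨r, hr, rfl⟩
        have := hB ⟨r, hr, rfl⟩
        linarith

lemma annCoeff_sub {g : ℂ → ℂ} (hf : MemHardy a b f) (hg : MemHardy a b g) (ha : 0 < a)
    (hab : a < b) (n : ℤ) : annCoeff a b (f - g) n = annCoeff a b f n - annCoeff a b g n := by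
  have hr := mid_mem hab
  have hr0 : 0 < (a + b) / 2 := ha.trans hr.1
  have hz : ContinuousOn (fun z : ℂ => z ^ (-n)) (Metric.sphere 0 ((a + b) / 2)) := fun z hz =>
    (continuousAt_zpow₀ z _ (Or.inl (by
      rintro rfl
      simp at hz
      linarith))).continuousWithinAt
  have h := Real.circleAverage_sub ((hz.mul (hf.continuousOn_sphere hr)).circleIntegrable hr0.le)
    ((hz.mul (hg.continuousOn_sphere hr)).circleIntegrable hr0.le)
  refine Eq.trans ?_ h
  unfold annCoeff laurentCoeff
  congr 1
  ext z
  simp [mul_sub]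

end MemHardy

/-! ### The component spaces -/

/-- The exponents `k + 2j` and `-d - k + 2 + 2j`, `j ≥ 0`. -/
def exponents (d k : ℕ) : Set ℤ :=
  {m | ∃ j : ℕ, m = k + 2 * j ∨ m = -(d : ℤ) - k + 2 + 2 * j}

lemma laurentCoeff_zpow_of_ne {r : ℝ} (hr : 0 < r) {m n : ℤ} (h : m ≠ n) :
    laurentCoeff (fun z => z ^ m) r n = 0 := by
  have hmn : m - n - 1 ≠ -1 := by omega
  unfold laurentCoeff
  rw [Real.circleAverage_eq_circleIntegral hr.ne', smul_eq_mul, mul_eq_zero]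
  refine Or.inr ?_
  refine Eq.trans (circleIntegral.integral_congr hr.le fun z hz => ?_)
    (circleIntegral.integral_sub_zpow_of_ne hmn 0 0 r)
  have hz0 : z ≠ 0 := by
    rintro rfl
    simp only [mem_sphere_zero_iff_norm, norm_zero] at hz
    linarith
  have e : m - n - 1 = -1 + (-n + m) := by ring
  simp only [sub_zero, smul_eq_mul]
  rw [e, zpow_add₀ hz0, zpow_add₀ hz0, zpow_neg_one]

lemma memHardy_zpow {a b : ℝ} (ha : 0 < a) (m : ℤ) :
    MemHardy a b (fun z => z ^ m) := by
  refine ⟨fun z hz => (differentiableAt_zpow.2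
    (Or.inl (norm_pos_iff.1 (ha.trans hz.1)))).differentiableWithinAt,
    a ^ (2 * m) + b ^ (2 * m), ?_⟩
  rintro _ ⟨r, hr, rfl⟩
  have hr0 : 0 < r := ha.trans hr.1
  have : meanSq (fun z => z ^ m) r = r ^ (2 * m) := by
    unfold meanSq
    rw [← Real.circleAverage_const (r ^ (2 * m)) 0 r]
    refine Real.circleAverage_congr_sphere fun z hz => ?_
    rw [mem_sphere_zero_iff_norm, abs_of_pos hr0] at hz
    simp only [norm_zpow, hz]
    rw [mul_comm, zpow_mul]
    norm_cast
  rw [this]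
  exact zpow_le_add ha ⟨hr.1.le, hr.2.le⟩ _

lemma memHardy_and_annCoeff_of_mem_genSpace {d k : ℕ} {a b : ℝ} (ha : 0 < a) (hab : a < b)
    {v : ℂ → ℂ} (hv : v ∈ genSpace d k) :
    MemHardy a b v ∧ ∀ n ∉ exponents d k, annCoeff a b v n = 0 := by
  have hgen : ∀ m ∈ exponents d k, MemHardy a b (fun z => z ^ m) ∧
      ∀ n ∉ exponents d k, annCoeff a b (fun z => z ^ m) n = 0 := fun m hm =>
    ⟨memHardy_zpow ha m, fun n hn =>
      laurentCoeff_zpow_of_ne (ha.trans (mid_mem hab).1) fun h => hn (h ▸ hm)⟩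
  have hzero : MemHardy a b 0 := by
    refine ⟨differentiableOn_const 0, 0, ?_⟩
    rintro _ ⟨r, -, rfl⟩
    simp [meanSq, Real.circleAverage_const]
  have hsmul : ∀ (c : ℂ) (f : ℂ → ℂ), MemHardy a b f → MemHardy a b (c • f) := by
    intro c f hf
    refine ⟨hf.1.const_smul c, ?_⟩
    obtain ⟨B, hB⟩ := hf.2
    refine ⟨‖c‖ ^ 2 * B, ?_⟩
    rintro _ ⟨r, hr, rfl⟩
    have : meanSq (c • f) r = ‖c‖ ^ 2 * meanSq f r := by
      unfold meanSq
      rw [← smul_eq_mul (‖c‖ ^ 2), ← Real.circleAverage_smul]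
      congr 1
      ext z
      simp [mul_pow]
    rw [this]
    exact mul_le_mul_of_nonneg_left (hB ⟨r, hr, rfl⟩) (by positivity)
  have hsmulc : ∀ (c : ℂ) (f : ℂ → ℂ) (n : ℤ),
      annCoeff a b (c • f) n = c * annCoeff a b f n := by
    intro c f n
    unfold annCoeff laurentCoeff
    rw [← smul_eq_mul c, ← Real.circleAverage_smul]
    congr 1
    ext z
    simp
    ring
  unfold genSpace at hv
  induction hv using Submodule.span_induction with
  | mem x hx =>
    rcases hx with ⟨j, rfl⟩ | ⟨j, rfl⟩
    · have := hgen (k + 2 * j) ⟨j, Or.inl rfl⟩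
      exact_mod_cast this
    · exact hgen _ ⟨j, Or.inr rfl⟩
  | zero =>
    refine ⟨hzero, fun n _ => ?_⟩
    simp [annCoeff, laurentCoeff, Real.circleAverage_const]
  | add x y _ _ hx hy =>
    -- written as a difference, so that the results on differences apply
    have e : x + y = x - (-1 : ℂ) • y := by simp
    rw [e]
    refine ⟨hx.1.sub (hsmul _ _ hy.1) ha, fun n hn => ?_⟩
    rw [hx.1.annCoeff_sub (hsmul _ _ hy.1) ha hab, hsmulc, hx.2 n hn, hy.2 n hn]
    simp
  | smul c x _ hx =>
    refine ⟨hsmul c x hx.1, fun n hn => ?_⟩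
    rw [hsmulc, hx.2 n hn, mul_zero]

/-- Functions of the component space have no Laurent coefficients outside the exponents which
generate it, as these coefficients depend continuously on the function. -/
lemma MemComponent.annCoeff_eq_zero {d k : ℕ} {a b : ℝ} (ha : 0 < a) (hab : a < b) {f : ℂ → ℂ}
    (hf : MemComponent d k a b f) {n : ℤ} (hn : n ∉ exponents d k) : annCoeff a b f n = 0 := by
  have hb : 0 < b := ha.trans hab
  have hpos : 0 < a ^ (2 * n) + b ^ (2 * n) := by positivity
  by_contra hne
  have hc : 0 < ‖annCoeff a b f n‖ ^ 2 * (a ^ (2 * n) + b ^ (2 * n)) := by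
    have := norm_pos_iff.2 hne
    positivity
  -- approximate to within the contribution of the `n`-th coefficient, which `v` does not have
  obtain ⟨v, hv, hlt⟩ := hf.2 _ hc
  obtain ⟨hv1, hv2⟩ := memHardy_and_annCoeff_of_mem_genSpace ha hab hv
  have h := (hf.1.sub hv1 ha).norm_annCoeff_sq_le ha hab n
  rw [hf.1.annCoeff_sub hv1 ha hab, hv2 n hn, sub_zero] at h
  exact absurd hlt (not_lt.2 h)

/-! ### The kernels -/

/-- The exponents which occur in the kernel `K_k(z, τ)` on the circle `|τ| = s`: the negative ones
if `s = a`, and the other ones if `s = b ≠ a`. -/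
def kerExponents (d k : ℕ) (a s : ℝ) : Set ℤ := {m | m ∈ exponents d k ∧ (m < 0 ↔ s = a)}

lemma norm_indicator_zpow_le {d k : ℕ} {a b s : ℝ} (ha : 0 < a) (hab : a < b)
    (hs : s = a ∨ s = b) {z τ : ℂ} (hz : z ∈ annulus a b) (hτ : ‖τ‖ = s) (m : ℤ) :
    ‖(kerExponents d k a s).indicator (fun m => (z / τ) ^ m) m‖ ≤ radialWeight a b ‖z‖ m := by
  by_cases hm : m ∈ kerExponents d k a s
  · rw [Set.indicator_of_mem hm, norm_zpow, norm_div, hτ, radialWeight]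
    rcases hs with rfl | rfl
    · rw [if_neg (not_le.2 (hm.2.2 rfl))]
    · rw [if_pos (not_lt.1 fun h => hab.ne' (hm.2.1 h))]
  · rw [Set.indicator_of_notMem hm, norm_zero]
    exact radialWeight_nonneg ha hz m

/-- As `d` is odd, the two progressions of exponents have no common member, so the sums that define
the kernel may be collected into one Laurent series. -/
lemma hasSum_compKernel {d k : ℕ} (hd : Odd d) {a b s : ℝ} (ha : 0 < a) (hab : a < b)
    (hs : s = a ∨ s = b) {z τ : ℂ} (hz : z ∈ annulus a b) (hτ : ‖τ‖ = s) :
    HasSum (fun m => (kerExponents d k a s).indicator (fun m => (z / τ) ^ m) m)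
      (compKernel d k a b z τ) := by
  have hsum : Summable fun m => (kerExponents d k a s).indicator (fun m => (z / τ) ^ m) m :=
    (summable_radialWeight ha hz).of_norm_bounded fun m =>
      norm_indicator_zpow_le ha hab hs hz hτ m
  rcases hs with rfl | rfl
  · rw [compKernel, if_neg (by rw [hτ]; exact hab.ne), if_pos hτ, kerThree]
    let e : {j : ℕ // -(d : ℤ) - k + 2 + 2 * j < 0} → ℤ := fun j =>
      -(d : ℤ) - k + 2 + 2 * (j : ℕ)
    have he : Function.Injective e := fun i j hij => by
      simp only [e] at hij
      exact Subtype.ext (by omega)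
    have hzero : ∀ m ∉ Set.range e,
        (kerExponents d k s s).indicator (fun m => (z / τ) ^ m) m = 0 := by
      intro m hm
      refine Set.indicator_of_notMem (fun h => hm ?_) _
      obtain ⟨⟨j, hj | hj⟩, h2⟩ := h
      · have := h2.2 rfl
        omega
      · exact ⟨⟨j, hj ▸ h2.2 rfl⟩, hj.symm⟩
    have h := he.hasSum_iff hzero (a := compKernel d k s b z τ)
    rw [compKernel, if_neg (by rw [hτ]; exact hab.ne), if_pos hτ, kerThree] at h
    rw [← h]
    have h2 := ((he.summable_iff hzero).2 hsum).hasSum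
    convert h2 using 1
    refine tsum_congr fun j => ?_
    rw [Function.comp_apply, Set.indicator_of_mem]
    exact ⟨⟨j, Or.inr rfl⟩, iff_of_true j.2 rfl⟩
  · rw [compKernel, if_pos hτ, kerOne, kerTwo]
    let F : ℤ → ℂ := fun m => (z / τ) ^ m
    let e₁ : ℕ → ℤ := fun j => k + 2 * j
    let e₂ : {j : ℕ // 0 ≤ -(d : ℤ) - k + 2 + 2 * j} → ℤ := fun j =>
      -(d : ℤ) - k + 2 + 2 * (j : ℕ)
    have he₁ : Function.Injective e₁ := fun i j hij => by
      simp only [e₁] at hij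
      omega
    have he₂ : Function.Injective e₂ := fun i j hij => by
      simp only [e₂] at hij
      exact Subtype.ext (by omega)
    have hdisj : Disjoint (Set.range e₁) (Set.range e₂) := by
      rw [Set.disjoint_left]
      rintro _ ⟨i, rfl⟩ ⟨j, hj⟩
      obtain ⟨n, hn⟩ := hd
      simp only [e₁, e₂] at hj
      omega
    have hset : kerExponents d k a s = Set.range e₁ ∪ Set.range e₂ := by
      ext m
      constructor
      · rintro ⟨⟨j, hj | hj⟩, h2⟩
        · exact Or.inl ⟨j, hj.symm⟩
        · have : 0 ≤ m := not_lt.1 fun h => hab.ne' (h2.1 h)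
          exact Or.inr ⟨⟨j, hj ▸ this⟩, hj.symm⟩
      · rintro (⟨j, rfl⟩ | ⟨j, rfl⟩)
        · refine ⟨⟨j, Or.inl rfl⟩, iff_of_false ?_ hab.ne'⟩
          simp only [e₁]
          omega
        · exact ⟨⟨j, Or.inr rfl⟩, iff_of_false (not_lt.2 j.2) hab.ne'⟩
    have h₁ : HasSum ((Set.range e₁).indicator F) (∑' j : ℕ, (z / τ) ^ (k + 2 * j)) := by
      have hz₁ : ∀ m ∉ Set.range e₁, (Set.range e₁).indicator F m = 0 := fun m hm =>
        Set.indicator_of_notMem hm _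
      have hs₁ : Summable ((Set.range e₁).indicator F) := by
        refine (hsum.indicator (Set.range e₁)).congr fun m => ?_
        rw [Set.indicator_indicator, hset, Set.inter_eq_left.2 Set.subset_union_left]
      have h2 := ((he₁.summable_iff hz₁).2 hs₁).hasSum
      rw [← he₁.hasSum_iff hz₁]
      convert h2 using 1
      refine tsum_congr fun j => ?_
      rw [Function.comp_apply, Set.indicator_of_mem (Set.mem_range_self j)]
      simp only [F, e₁]
      norm_cast
    have h₂ : HasSum ((Set.range e₂).indicator F)
        (∑' j : {j : ℕ // 0 ≤ -(d : ℤ) - k + 2 + 2 * j},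
          (z / τ) ^ (-(d : ℤ) - k + 2 + 2 * (j : ℕ))) := by
      have hz₂ : ∀ m ∉ Set.range e₂, (Set.range e₂).indicator F m = 0 := fun m hm =>
        Set.indicator_of_notMem hm _
      have hs₂ : Summable ((Set.range e₂).indicator F) := by
        refine (hsum.indicator (Set.range e₂)).congr fun m => ?_
        rw [Set.indicator_indicator, hset, Set.inter_eq_left.2 Set.subset_union_right]
      have h2 := ((he₂.summable_iff hz₂).2 hs₂).hasSum
      rw [← he₂.hasSum_iff hz₂]
      convert h2 using 1
      refine tsum_congr fun j => ?_
      rw [Function.comp_apply, Set.indicator_of_mem (Set.mem_range_self j)]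
    rw [hset, Set.indicator_union_of_disjoint hdisj]
    exact h₁.add h₂

lemma norm_compKernel_le {d k : ℕ} (hd : Odd d) {a b : ℝ} (ha : 0 < a) (hab : a < b)
    {z τ : ℂ} (hz : z ∈ annulus a b) (hτ : ‖τ‖ = a ∨ ‖τ‖ = b) :
    ‖compKernel d k a b z τ‖ ≤ ∑' m, radialWeight a b ‖z‖ m :=
  (hasSum_compKernel hd ha hab hτ hz rfl).norm_le_of_bounded (summable_radialWeight ha hz).hasSum
    fun m => norm_indicator_zpow_le ha hab hτ hz rfl m

lemma norm_circleMap_zero_of_pos {s : ℝ} (hs : 0 < s) (φ : ℝ) : ‖circleMap 0 s φ‖ = s := by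
  rw [norm_circleMap_zero, abs_of_pos hs]

lemma continuous_compKernel_circleMap {d k : ℕ} (hd : Odd d) {a b s : ℝ} (ha : 0 < a)
    (hab : a < b) (hs : s = a ∨ s = b) {z : ℂ} (hz : z ∈ annulus a b) :
    Continuous fun φ : ℝ => compKernel d k a b z (circleMap 0 s φ) := by
  have hs0 : 0 < s := by
    rcases hs with rfl | rfl
    exacts [ha, ha.trans hab]
  have hz0 : z ≠ 0 := norm_pos_iff.1 (ha.trans hz.1)
  have e : (fun φ : ℝ => compKernel d k a b z (circleMap 0 s φ)) = fun φ : ℝ =>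
      ∑' m, (kerExponents d k a s).indicator (fun m => (z / circleMap 0 s φ) ^ m) m := by
    ext φ
    exact (hasSum_compKernel hd ha hab hs hz (norm_circleMap_zero_of_pos hs0 φ)).tsum_eq.symm
  rw [e]
  refine continuous_tsum (fun m => ?_) (summable_radialWeight ha hz)
    fun m φ => norm_indicator_zpow_le ha hab hs hz (norm_circleMap_zero_of_pos hs0 φ) m
  by_cases hm : m ∈ kerExponents d k a s
  · simp only [Set.indicator_of_mem hm]
    have hc : ∀ φ, circleMap 0 s φ ≠ 0 := fun φ => circleMap_ne_center hs0.ne'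
    exact (continuous_const.div (continuous_circleMap 0 s) hc).zpow₀ m fun φ =>
      Or.inl (div_ne_zero hz0 (hc φ))
  · simp only [Set.indicator_of_notMem hm]
    exact continuous_const

section Kernel

variable {d : ℕ} {Y : (k : ℕ) → Fin (harmDim d k) → EuclideanSpace ℝ (Fin d) → ℝ}

lemma norm_kernelTerm_le (hY : IsHarmonicBasis Y) (hd : Odd d) {a b L : ℝ} (ha : 0 < a)
    (hab : a < b) (hL : 1 < L) {z τ : ℂ} (hz : z ∈ annulus a b) (hτ : ‖τ‖ = a ∨ ‖τ‖ = b)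
    (θ θ' : Sph d) (p : HarmIndex d) :
    ‖kernelTerm Y a b L z θ τ θ' p‖ ≤
      (∑' m, radialWeight a b ‖z‖ m) * ((L ^ (2 * p.1))⁻¹ * harmBound d p.1 ^ 2) := by
  have hL0 : 0 < L := by linarith
  have hM : 0 ≤ ∑' m, radialWeight a b ‖z‖ m := tsum_nonneg fun m => radialWeight_nonneg ha hz m
  have h1 := hY.abs_le hd.pos p.1 p.2 θ
  have h2 := hY.abs_le hd.pos p.1 p.2 θ'
  have h3 := norm_compKernel_le (k := p.1) hd ha hab hz hτ
  have h0 := harmBound_nonneg d p.1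
  rw [kernelTerm, norm_mul, norm_mul, norm_mul, norm_inv, norm_pow, Complex.norm_real,
    Complex.norm_real, Complex.norm_real, Real.norm_of_nonneg hL0.le, Real.norm_eq_abs,
    Real.norm_eq_abs]
  calc (L ^ (2 * p.1))⁻¹ * ‖compKernel d p.1 a b z τ‖ * |Y p.1 p.2 θ| * |Y p.1 p.2 θ'|
      ≤ (L ^ (2 * p.1))⁻¹ * (∑' m, radialWeight a b ‖z‖ m) * harmBound d p.1 *
          harmBound d p.1 := by gcongr
    _ = _ := by ring

lemma summable_kernelTerm (hY : IsHarmonicBasis Y) (hd : Odd d) {a b L : ℝ} (ha : 0 < a)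
    (hab : a < b) (hL : 1 < L) {z τ : ℂ} (hz : z ∈ annulus a b) (hτ : ‖τ‖ = a ∨ ‖τ‖ = b)
    (θ θ' : Sph d) : Summable (kernelTerm Y a b L z θ τ θ') :=
  ((summable_harmBound_sq hL).mul_left _).of_norm_bounded fun p =>
    norm_kernelTerm_le hY hd ha hab hL hz hτ θ θ' p

instance : IsFiniteMeasure (circSphMeasure d) := by
  unfold circSphMeasure
  infer_instance

lemma memLp_slice_cauchyKernel (hY : IsHarmonicBasis Y) (hd : Odd d) {a b L s : ℝ} (ha : 0 < a)
    (hab : a < b) (hL : 1 < L) (hs : s = a ∨ s = b) {z : ℂ} (hz : z ∈ annulus a b) (θ : Sph d) :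
    MemLp (slice (cauchyKernel Y a b L z θ) s) 2 (circSphMeasure d) := by
  have hs0 : 0 < s := by
    rcases hs with rfl | rfl
    exacts [ha, ha.trans hab]
  have hsum := (summable_harmBound_sq (d := d) hL).mul_left (∑' m, radialWeight a b ‖z‖ m)
  have hτ : ∀ φ, ‖circleMap 0 s φ‖ = a ∨ ‖circleMap 0 s φ‖ = b := fun φ => by
    rwa [norm_circleMap_zero_of_pos hs0 φ]
  have hcont : Continuous (slice (cauchyKernel Y a b L z θ) s) := by
    refine continuous_tsum (fun p => ?_) hsum
      fun p q => norm_kernelTerm_le hY hd ha hab hL hz (hτ q.1) θ q.2 p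
    unfold kernelTerm
    refine ((continuous_const.mul ?_).mul continuous_const).mul ?_
    · exact (continuous_compKernel_circleMap hd ha hab hs hz).comp continuous_fst
    · exact (hY.continuous_ofReal p.1 p.2).comp (continuous_subtype_val.comp continuous_snd)
  refine MemLp.of_bound hcont.aestronglyMeasurable (∑' p : HarmIndex d,
    (∑' m, radialWeight a b ‖z‖ m) * ((L ^ (2 * p.1))⁻¹ * harmBound d p.1 ^ 2))
    (ae_of_all _ fun q => ?_)
  exact tsum_of_norm_bounded hsum.hasSum fun p =>
    norm_kernelTerm_le hY hd ha hab hL hz (hτ q.1) θ q.2 p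

/-- The Laplace-Fourier coefficients of the kernel are read off from its definition. -/
lemma coeff_cauchyKernel (hY : IsHarmonicBasis Y) (hd : Odd d) {a b L : ℝ} (ha : 0 < a)
    (hab : a < b) (hL : 1 < L) {z τ : ℂ} (hz : z ∈ annulus a b) (hτ : ‖τ‖ = a ∨ ‖τ‖ = b)
    (θ : Sph d) (p : HarmIndex d) :
    coeff Y (cauchyKernel Y a b L z θ) p τ =
      ((L : ℂ) ^ (2 * p.1))⁻¹ * compKernel d p.1 a b z τ * ((Y p.1 p.2 θ : ℝ) : ℂ) := by
  have hsum := (summable_harmBound_sq (d := d) hL).mul_left (∑' m, radialWeight a b ‖z‖ m)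
  have hcont : ∀ q : HarmIndex d, Continuous fun θ' : Sph d => ((Y q.1 q.2 θ' : ℝ) : ℂ) :=
    fun q => (hY.continuous_ofReal q.1 q.2).comp continuous_subtype_val
  have h := hasSum_integral_of_dominated_convergence (μ := sphMeasure d)
    (F := fun q θ' => kernelTerm Y a b L z θ τ θ' q * ((Y p.1 p.2 θ' : ℝ) : ℂ))
    (f := fun θ' => cauchyKernel Y a b L z θ τ θ' * ((Y p.1 p.2 θ' : ℝ) : ℂ))
    (fun q _ => (∑' m, radialWeight a b ‖z‖ m) * ((L ^ (2 * q.1))⁻¹ * harmBound d q.1 ^ 2) *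
      harmBound d p.1)
    (fun q => by
      unfold kernelTerm
      exact ((continuous_const.mul (hcont q)).mul (hcont p)).aestronglyMeasurable)
    (fun q => ae_of_all _ fun θ' => by
      rw [norm_mul, Complex.norm_real, Real.norm_eq_abs]
      refine mul_le_mul (norm_kernelTerm_le hY hd ha hab hL hz hτ θ θ' q)
        (hY.abs_le hd.pos p.1 p.2 θ') (abs_nonneg _) ?_
      exact (norm_nonneg _).trans (norm_kernelTerm_le hY hd ha hab hL hz hτ θ θ' q))
    (ae_of_all _ fun θ' => hsum.mul_right _) (integrable_const _)
    (ae_of_all _ fun θ' => (summable_kernelTerm hY hd ha hab hL hz hτ θ θ').hasSum.mul_right _)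
  have hterm : ∀ q : HarmIndex d, ∫ θ' : Sph d,
      kernelTerm Y a b L z θ τ θ' q * ((Y p.1 p.2 θ' : ℝ) : ℂ) ∂(sphMeasure d) =
      if q = p then ((L : ℂ) ^ (2 * p.1))⁻¹ * compKernel d p.1 a b z τ *
        ((Y p.1 p.2 θ : ℝ) : ℂ) else 0 := by
    intro q
    simp_rw [kernelTerm, mul_assoc _ ((Y q.1 q.2 _ : ℝ) : ℂ) ((Y p.1 p.2 _ : ℝ) : ℂ)]
    rw [integral_const_mul, hY.integral_mul hd.pos]
    split_ifs with hqp
    · subst hqp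
      simp
    · simp
  simp_rw [hterm] at h
  exact h.unique (hasSum_ite_eq p _)

end Kernel

/-! ### Boundary limits -/

open scoped BoundedContinuousFunction

lemma laurentCoeff_zpow_self {r : ℝ} (hr : 0 < r) (m : ℤ) :
    laurentCoeff (fun z => z ^ m) r m = 1 := by
  unfold laurentCoeff
  rw [← Real.circleAverage_const (1 : ℂ) 0 r]
  refine Real.circleAverage_congr_sphere fun z hz => ?_
  have hz0 : z ≠ 0 := by
    rintro rfl
    rw [mem_sphere_zero_iff_norm, abs_of_pos hr, norm_zero] at hz
    exact hr.ne hz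
  simp only
  rw [← zpow_add₀ hz0, neg_add_cancel, zpow_zero]

/-- `√(2π)`, the norm of `e^{imφ}` on `(0, 2π]`. -/
def rootTwoPi : ℝ := Real.sqrt (2 * Real.pi)

lemma rootTwoPi_pos : 0 < rootTwoPi := Real.sqrt_pos.2 Real.two_pi_pos

lemma rootTwoPi_sq : rootTwoPi ^ 2 = 2 * Real.pi := Real.sq_sqrt Real.two_pi_pos.le

section Modes

variable {d : ℕ} {Y : (k : ℕ) → Fin (harmDim d k) → EuclideanSpace ℝ (Fin d) → ℝ}

/-- The normalized function `(φ, θ) ↦ e^{imφ} Y_{k,ℓ}(θ)`, a bounded continuous function. -/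
def harmMode (hY : IsHarmonicBasis Y) (hd : Odd d) (q : HarmIndex d × ℤ) : (ℝ × Sph d) →ᵇ ℂ :=
  BoundedContinuousFunction.ofNormedAddCommGroup
    (fun x => (rootTwoPi : ℂ)⁻¹ * Complex.exp (x.1 * Complex.I) ^ q.2 *
      ((Y q.1.1 q.1.2 x.2 : ℝ) : ℂ))
    (by
      refine (continuous_const.mul ?_).mul ((hY.continuous_ofReal _ _).comp
        (continuous_subtype_val.comp continuous_snd))
      have : Continuous fun x : ℝ × Sph d => Complex.exp (x.1 * Complex.I) := by fun_prop
      exact this.zpow₀ _ fun x => Or.inl (Complex.exp_ne_zero _))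
    (rootTwoPi⁻¹ * harmBound d q.1.1)
    (fun x => by
      rw [norm_mul, norm_mul, norm_inv, norm_zpow, Complex.norm_exp_ofReal_mul_I, one_zpow, mul_one,
        Complex.norm_real, Complex.norm_real, Real.norm_of_nonneg rootTwoPi_pos.le,
        Real.norm_eq_abs]
      have := rootTwoPi_pos
      gcongr
      exact hY.abs_le hd.pos _ _ _)

lemma harmMode_apply (hY : IsHarmonicBasis Y) (hd : Odd d) (q : HarmIndex d × ℤ) (x : ℝ × Sph d) :
    harmMode hY hd q x = (rootTwoPi : ℂ)⁻¹ * Complex.exp (x.1 * Complex.I) ^ q.2 *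
      ((Y q.1.1 q.1.2 x.2 : ℝ) : ℂ) := rfl

lemma norm_harmMode_le (hY : IsHarmonicBasis Y) (hd : Odd d) (q : HarmIndex d × ℤ) :
    ‖harmMode hY hd q‖ ≤ rootTwoPi⁻¹ * harmBound d q.1.1 :=
  BoundedContinuousFunction.norm_ofNormedAddCommGroup_le _
    (mul_nonneg (inv_nonneg.2 rootTwoPi_pos.le) (harmBound_nonneg _ _)) _

lemma conj_harmMode (hY : IsHarmonicBasis Y) (hd : Odd d) (q : HarmIndex d × ℤ) (x : ℝ × Sph d) :
    (starRingEnd ℂ) (harmMode hY hd q x) =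
      (rootTwoPi : ℂ)⁻¹ * Complex.exp (x.1 * Complex.I) ^ (-q.2) *
        ((Y q.1.1 q.1.2 x.2 : ℝ) : ℂ) := by
  rw [harmMode_apply, map_mul, map_mul, map_inv₀, Complex.conj_ofReal, Complex.conj_ofReal,
    map_zpow₀, ← Complex.exp_conj, map_mul, Complex.conj_ofReal, Complex.conj_I, mul_neg,
    Complex.exp_neg, inv_zpow, zpow_neg]

/-- The class of `harmMode` in `L²`. -/
def harmModeLp (hY : IsHarmonicBasis Y) (hd : Odd d) (q : HarmIndex d × ℤ) :
    Lp ℂ 2 (circSphMeasure d) :=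
  BoundedContinuousFunction.toLp 2 (circSphMeasure d) ℂ (harmMode hY hd q)

lemma orthonormal_harmModeLp (hY : IsHarmonicBasis Y) (hd : Odd d) :
    Orthonormal ℂ (harmModeLp hY hd) := by
  classical
  rw [orthonormal_iff_ite]
  rintro ⟨p, m⟩ ⟨q, n⟩
  unfold harmModeLp
  rw [BoundedContinuousFunction.inner_toLp]
  have e : ∀ x : ℝ × Sph d, harmMode hY hd (q, n) x *
      (starRingEnd ℂ) (harmMode hY hd (p, m) x) =
      (((2 * Real.pi : ℝ) : ℂ)⁻¹ * (Complex.exp (x.1 * Complex.I) ^ (-m) *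
        Complex.exp (x.1 * Complex.I) ^ n)) *
        (((Y p.1 p.2 x.2 : ℝ) : ℂ) * ((Y q.1 q.2 x.2 : ℝ) : ℂ)) := by
    intro x
    rw [conj_harmMode, harmMode_apply, ← rootTwoPi_sq]
    push_cast
    ring
  simp_rw [e]
  rw [circSphMeasure, integral_prod_mul (fun φ : ℝ => ((2 * Real.pi : ℝ) : ℂ)⁻¹ *
    (Complex.exp (φ * Complex.I) ^ (-m) * Complex.exp (φ * Complex.I) ^ n))
    (fun θ : Sph d => ((Y p.1 p.2 θ : ℝ) : ℂ) * ((Y q.1 q.2 θ : ℝ) : ℂ)), hY.integral_mul hd.pos]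
  have hcirc : ∫ φ : ℝ in Set.Ioc 0 (2 * Real.pi), ((2 * Real.pi : ℝ) : ℂ)⁻¹ *
      (Complex.exp (φ * Complex.I) ^ (-m) * Complex.exp (φ * Complex.I) ^ n) =
      laurentCoeff (fun z => z ^ n) 1 m := by
    rw [laurentCoeff, Real.circleAverage_def, integral_const_mul,
      intervalIntegral.integral_of_le Real.two_pi_pos.le, Complex.real_smul, Complex.ofReal_inv]
    simp [circleMap]
  rw [hcirc]
  by_cases hmn : m = n
  · subst hmn
    rw [laurentCoeff_zpow_self one_pos]
    simp
  · rw [laurentCoeff_zpow_of_ne one_pos (Ne.symm hmn)]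
    simp [hmn]

/-- The isometric embedding of `ℓ²` into `L²((0, 2π) × 𝕊)` given by the functions `harmMode`. -/
def synthesis (hY : IsHarmonicBasis Y) (hd : Odd d) :
    lp (fun _ : HarmIndex d × ℤ => ℂ) 2 →ₗᵢ[ℂ] Lp ℂ 2 (circSphMeasure d) :=
  (orthonormal_harmModeLp hY hd).orthogonalFamily.linearIsometry

lemma hasSum_synthesis (hY : IsHarmonicBasis Y) (hd : Odd d)
    (x : lp (fun _ : HarmIndex d × ℤ => ℂ) 2) :
    HasSum (fun q => x q • harmModeLp hY hd q) (synthesis hY hd x) := by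
  have := (orthonormal_harmModeLp hY hd).orthogonalFamily.hasSum_linearIsometry x
  simpa [synthesis] using this

lemma inner_harmModeLp_synthesis (hY : IsHarmonicBasis Y) (hd : Odd d)
    (x : lp (fun _ : HarmIndex d × ℤ => ℂ) 2) (q : HarmIndex d × ℤ) :
    inner ℂ (harmModeLp hY hd q) (synthesis hY hd x) = x q := by
  classical
  have h1 : synthesis hY hd (lp.single 2 q 1) = harmModeLp hY hd q := by
    simp [synthesis]
  rw [← h1, LinearIsometry.inner_map_map, lp.inner_single_left]
  simp

end Modes

section Limit

variable {d : ℕ} {Y : (k : ℕ) → Fin (harmDim d k) → EuclideanSpace ℝ (Fin d) → ℝ}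
variable {a b : ℝ} {c : HarmIndex d × ℤ → ℂ}

open Classical in
/-- The coefficients, with respect to the functions `harmMode`, of
`(φ, θ) ↦ ∑ c_{k,ℓ,m} (s e^{iφ})ᵐ Y_{k,ℓ}(θ)`; the value is `0` if they are not square summable. -/
def modeVec (c : HarmIndex d × ℤ → ℂ) (s : ℝ) : lp (fun _ : HarmIndex d × ℤ => ℂ) 2 :=
  if h : Memℓp (fun q : HarmIndex d × ℤ => (rootTwoPi : ℂ) * (c q * (s : ℂ) ^ q.2)) 2 then
    ⟨_, h⟩ else 0

lemma norm_rootTwoPi_mul_sq (w : ℂ) :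
    ‖(rootTwoPi : ℂ) * w‖ ^ 2 = 2 * Real.pi * ‖w‖ ^ 2 := by
  rw [norm_mul, mul_pow, Complex.norm_real, Real.norm_of_nonneg rootTwoPi_pos.le, rootTwoPi_sq]

lemma modeVec_apply (ha : 0 < a)
    (hc : Summable fun q => ‖c q‖ ^ 2 * (a ^ (2 * q.2) + b ^ (2 * q.2))) {s : ℝ}
    (hs : s ∈ Set.Icc a b) (q : HarmIndex d × ℤ) :
    modeVec c s q = (rootTwoPi : ℂ) * (c q * (s : ℂ) ^ q.2) := by
  have hs0 : 0 < s := ha.trans_le hs.1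
  have hmem : Memℓp (fun q : HarmIndex d × ℤ => (rootTwoPi : ℂ) * (c q * (s : ℂ) ^ q.2)) 2 := by
    refine memℓp_gen ?_
    simp only [ENNReal.toReal_ofNat, Real.rpow_ofNat, norm_rootTwoPi_mul_sq]
    refine (hc.of_nonneg_of_le (fun q => by positivity) fun q => ?_).mul_left _
    rw [norm_mul, mul_pow, norm_zpow, Complex.norm_real, Real.norm_of_nonneg hs0.le,
      ← zpow_natCast (s ^ q.2), ← zpow_mul, mul_comm q.2]
    gcongr
    exact zpow_le_add ha hs _
  rw [modeVec, dif_pos hmem]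

lemma sub_sq_le_add_sq {x y : ℝ} (hx : 0 ≤ x) (hy : 0 ≤ y) : (x - y) ^ 2 ≤ x ^ 2 + y ^ 2 := by
  nlinarith [mul_nonneg hx hy]

/-- Dominated convergence, with the coefficients on the two boundary circles as the majorant. -/
lemma tendsto_modeVec (ha : 0 < a)
    (hc : Summable fun q => ‖c q‖ ^ 2 * (a ^ (2 * q.2) + b ^ (2 * q.2))) {s : ℝ}
    (hs : s ∈ Set.Icc a b) : Tendsto (modeVec c) (𝓝[Set.Ioo a b] s) (𝓝 (modeVec c s)) := by
  have hs0 : 0 < s := ha.trans_le hs.1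
  rw [tendsto_iff_norm_sub_tendsto_zero]
  have hsq : Tendsto (fun r => ‖modeVec c r - modeVec c s‖ ^ 2) (𝓝[Set.Ioo a b] s) (𝓝 0) := by
    have h := tendsto_tsum_of_dominated_convergence (𝓕 := 𝓝[Set.Ioo a b] s)
      (f := fun (r : ℝ) (q : HarmIndex d × ℤ) =>
        2 * Real.pi * (‖c q‖ ^ 2 * (r ^ q.2 - s ^ q.2) ^ 2))
      (g := fun q => 2 * Real.pi * (‖c q‖ ^ 2 * (s ^ q.2 - s ^ q.2) ^ 2))
      ((hc.mul_left 2).mul_left (2 * Real.pi)) (fun q => ?_) ?_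
    · simp only [sub_self, ne_eq, OfNat.ofNat_ne_zero, not_false_eq_true, zero_pow, mul_zero,
        tsum_zero] at h
      refine h.congr' ?_
      filter_upwards [self_mem_nhdsWithin] with r hr
      have hl := lp.norm_rpow_eq_tsum (p := 2) (by norm_num) (modeVec c r - modeVec c s)
      simp only [ENNReal.toReal_ofNat, Real.rpow_ofNat] at hl
      rw [hl]
      refine tsum_congr fun q => ?_
      rw [lp.coeFn_sub, Pi.sub_apply, modeVec_apply ha hc ⟨hr.1.le, hr.2.le⟩,
        modeVec_apply ha hc hs, ← mul_sub, ← mul_sub, norm_rootTwoPi_mul_sq, norm_mul, mul_pow]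
      congr 2
      have : ((r : ℂ) ^ q.2 - (s : ℂ) ^ q.2) = ((r ^ q.2 - s ^ q.2 : ℝ) : ℂ) := by push_cast; ring
      rw [this, Complex.norm_real, Real.norm_eq_abs, sq_abs]
    · refine Tendsto.mono_left ?_ nhdsWithin_le_nhds
      exact (((((continuousAt_zpow₀ s _ (Or.inl hs0.ne')).tendsto).sub_const _).pow 2).const_mul
        _).const_mul _
    · filter_upwards [self_mem_nhdsWithin] with r hr q
      have hr0 : 0 < r := ha.trans hr.1
      rw [Real.norm_of_nonneg (by positivity), ← mul_assoc 2 (_ ^ 2), mul_comm 2 (_ ^ 2),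
        mul_assoc (_ ^ 2)]
      have hpow : ∀ t : ℝ, (t ^ q.2) ^ 2 = t ^ (2 * q.2) := fun t => by
        rw [← zpow_natCast (t ^ q.2), ← zpow_mul, mul_comm q.2]
        norm_cast
      have h1 := zpow_le_add ha ⟨hr.1.le, hr.2.le⟩ (2 * q.2)
      have h2 := zpow_le_add ha hs (2 * q.2)
      have h3 := sub_sq_le_add_sq (zpow_pos hr0 q.2).le (zpow_pos hs0 q.2).le
      rw [hpow, hpow] at h3
      have h4 : (r ^ q.2 - s ^ q.2) ^ 2 ≤ 2 * (a ^ (2 * q.2) + b ^ (2 * q.2)) := by linarith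
      gcongr
  have := hsq.sqrt
  simpa [Real.sqrt_sq (norm_nonneg _)] using this

/-- The function on the boundary with given restrictions (as functions of `φ` and `θ`) to its two
parts. -/
def boundaryFun (a : ℝ) (u v : ℝ × Sph d → ℂ) (τ : ℂ) (θ : Sph d) : ℂ :=
  open Classical in
  if ‖τ‖ = a then u (toIocMod Real.two_pi_pos 0 τ.arg, θ)
  else v (toIocMod Real.two_pi_pos 0 τ.arg, θ)

lemma toIocMod_arg_circleMap {s φ : ℝ} (hs : 0 < s) (hφ : φ ∈ Set.Ioc 0 (2 * Real.pi)) :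
    toIocMod Real.two_pi_pos 0 (circleMap 0 s φ).arg = φ := by
  rw [circleMap, zero_add, Complex.arg_real_mul _ hs, Complex.arg_exp_mul_I, toIocMod_toIocMod,
    toIocMod_eq_self]
  simpa using hφ

lemma ae_circSphMeasure_mem : ∀ᵐ x ∂(circSphMeasure d), x.1 ∈ Set.Ioc 0 (2 * Real.pi) :=
  Measure.quasiMeasurePreserving_fst.ae (ae_restrict_mem measurableSet_Ioc)

/-- The argument `τ.arg`, brought into `(0, 2π]`, recovers the angle `φ` of `τ = a e^{iφ}`. -/
lemma slice_boundaryFun_left (ha : 0 < a) (u v : ℝ × Sph d → ℂ) :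
    slice (boundaryFun a u v) a =ᵐ[circSphMeasure d] u := by
  filter_upwards [ae_circSphMeasure_mem] with x hx
  rw [slice, boundaryFun, if_pos (norm_circleMap_zero_of_pos ha _), toIocMod_arg_circleMap ha hx]

lemma slice_boundaryFun_right (ha : 0 < a) (hab : a < b) (u v : ℝ × Sph d → ℂ) :
    slice (boundaryFun a u v) b =ᵐ[circSphMeasure d] v := by
  filter_upwards [ae_circSphMeasure_mem] with x hx
  have hb := ha.trans hab
  rw [slice, boundaryFun, if_neg, toIocMod_arg_circleMap hb hx]
  rw [norm_circleMap_zero_of_pos hb]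
  exact hab.ne'

lemma tendsto_eLpNorm_slice_sub (hY : IsHarmonicBasis Y) (hd : Odd d) (ha : 0 < a)
    (hc : Summable fun q => ‖c q‖ ^ 2 * (a ^ (2 * q.2) + b ^ (2 * q.2)))
    {f : ℂ → Sph d → ℂ}
    (hf : ∀ r ∈ Set.Ioo a b, slice f r =ᵐ[circSphMeasure d] synthesis hY hd (modeVec c r))
    {s : ℝ} (hs : s ∈ Set.Icc a b) {u : ℝ × Sph d → ℂ}
    (hu : u =ᵐ[circSphMeasure d] synthesis hY hd (modeVec c s)) :
    Tendsto (fun r => eLpNorm (slice f r - u) 2 (circSphMeasure d)) (𝓝[Set.Ioo a b] s) (𝓝 0) := by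
  have h1 := ((synthesis hY hd).continuous.tendsto _).comp (tendsto_modeVec ha hc hs)
  have h2 := (tendsto_iff_norm_sub_tendsto_zero.1 h1)
  have h3 := ENNReal.tendsto_ofReal h2
  rw [ENNReal.ofReal_zero] at h3
  refine h3.congr' ?_
  filter_upwards [self_mem_nhdsWithin] with r hr
  rw [ofReal_norm, Lp.enorm_def]
  refine eLpNorm_congr_ae ?_
  refine (Lp.coeFn_sub _ _).trans ?_
  exact ((hf r hr).symm.sub hu.symm)

/-- The boundary limit exists: its coefficients are the limits of those of the slices. -/
lemma exists_isBoundaryLimit (hY : IsHarmonicBasis Y) (hd : Odd d) (ha : 0 < a) (hab : a < b)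
    (hc : Summable fun q => ‖c q‖ ^ 2 * (a ^ (2 * q.2) + b ^ (2 * q.2)))
    {f : ℂ → Sph d → ℂ}
    (hf : ∀ r ∈ Set.Ioo a b, slice f r =ᵐ[circSphMeasure d] synthesis hY hd (modeVec c r)) :
    ∃ g, IsBoundaryLimit a b f g := by
  refine ⟨boundaryFun a (synthesis hY hd (modeVec c a)) (synthesis hY hd (modeVec c b)), ⟨?_, ?_⟩,
    ?_, ?_⟩
  · exact (memLp_congr_ae (slice_boundaryFun_left ha _ _)).2 (Lp.memLp _)
  · exact (memLp_congr_ae (slice_boundaryFun_right ha hab _ _)).2 (Lp.memLp _)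
  · rw [← nhdsWithin_Ioo_eq_nhdsGT hab]
    exact tendsto_eLpNorm_slice_sub hY hd ha hc hf ⟨le_rfl, hab.le⟩ (slice_boundaryFun_left ha _ _)
  · rw [← nhdsWithin_Ioo_eq_nhdsLT hab]
    exact tendsto_eLpNorm_slice_sub hY hd ha hc hf ⟨hab.le, le_rfl⟩
      (slice_boundaryFun_right ha hab _ _)

/-- The boundary limit is unique up to null sets. -/
lemma IsBoundaryLimit.slice_ae_eq (hY : IsHarmonicBasis Y) (hd : Odd d) (ha : 0 < a) (hab : a < b)
    (hc : Summable fun q => ‖c q‖ ^ 2 * (a ^ (2 * q.2) + b ^ (2 * q.2)))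
    {f : ℂ → Sph d → ℂ}
    (hf : ∀ r ∈ Set.Ioo a b, slice f r =ᵐ[circSphMeasure d] synthesis hY hd (modeVec c r))
    {g : ℂ → Sph d → ℂ} (hg : IsBoundaryLimit a b f g) {s : ℝ} (hs : s = a ∨ s = b) :
    slice g s =ᵐ[circSphMeasure d] synthesis hY hd (modeVec c s) := by
  have hs' : s ∈ Set.Icc a b := by
    rcases hs with rfl | rfl
    exacts [⟨le_rfl, hab.le⟩, ⟨hab.le, le_rfl⟩]
  have : (𝓝[Set.Ioo a b] s).NeBot := by
    rw [← mem_closure_iff_nhdsWithin_neBot, closure_Ioo hab.ne]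
    exact hs'
  have hmem : MemLp (slice g s) 2 (circSphMeasure d) := by
    rcases hs with rfl | rfl
    exacts [hg.1.1, hg.1.2]
  have hlim : Tendsto (fun r => eLpNorm (slice f r - slice g s) 2 (circSphMeasure d))
      (𝓝[Set.Ioo a b] s) (𝓝 0) := by
    rcases hs with rfl | rfl
    · rw [nhdsWithin_Ioo_eq_nhdsGT hab]
      exact hg.2.1
    · rw [nhdsWithin_Ioo_eq_nhdsLT hab]
      exact hg.2.2
  have hlim' := tendsto_eLpNorm_slice_sub hY hd ha hc hf hs' (EventuallyEq.refl _ _)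
  have hsum := hlim.add hlim'
  rw [add_zero] at hsum
  have hmem' := Lp.aestronglyMeasurable (synthesis hY hd (modeVec c s))
  generalize ((synthesis hY hd (modeVec c s) : Lp ℂ 2 (circSphMeasure d)) : ℝ × Sph d → ℂ) = u
    at hlim' hsum hmem' ⊢
  have hle : eLpNorm (slice g s - u) 2 (circSphMeasure d) ≤ 0 := by
    refine ge_of_tendsto hsum ?_
    filter_upwards [self_mem_nhdsWithin] with r hr
    have hmf : AEStronglyMeasurable (slice f r) (circSphMeasure d) :=
      (Lp.aestronglyMeasurable _).congr (hf r hr).symm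
    have e : slice g s - u = (slice g s - slice f r) + (slice f r - u) := by abel
    rw [e, eLpNorm_sub_comm (slice f r) (slice g s)]
    exact eLpNorm_add_le (hmem.1.sub hmf) (hmf.sub hmem') one_le_two
  have h0 := (eLpNorm_eq_zero_iff (hmem.1.sub hmem') two_ne_zero).1 (nonpos_iff_eq_zero.1 hle)
  filter_upwards [h0] with x hx
  simpa [sub_eq_zero] using hx

lemma integrable_slice_mul {g : ℂ → Sph d → ℂ} {s : ℝ}
    (hg : MemLp (slice g s) 2 (circSphMeasure d)) (hY : IsHarmonicBasis Y) (hd : Odd d)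
    (p : HarmIndex d) :
    Integrable (fun x : ℝ × Sph d => slice g s x * ((Y p.1 p.2 x.2 : ℝ) : ℂ))
      (circSphMeasure d) := by
  refine (hg.integrable one_le_two).mul_bdd (c := harmBound d p.1) ?_ (ae_of_all _ fun x => ?_)
  · exact ((hY.continuous_ofReal p.1 p.2).comp
      (continuous_subtype_val.comp continuous_snd)).aestronglyMeasurable
  · rw [Complex.norm_real]
    exact hY.abs_le hd.pos _ _ _

lemma circleIntegrable_coeff {g : ℂ → Sph d → ℂ} {s : ℝ}
    (hg : MemLp (slice g s) 2 (circSphMeasure d)) (hY : IsHarmonicBasis Y) (hd : Odd d)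
    (p : HarmIndex d) : CircleIntegrable (coeff Y g p) 0 s := by
  rw [CircleIntegrable, intervalIntegrable_iff_integrableOn_Ioc_of_le Real.two_pi_pos.le]
  exact (integrable_slice_mul hg hY hd p).integral_prod_left

/-- The Laurent coefficients of the components of the boundary function are those of `f`. -/
lemma laurentCoeff_coeff (hY : IsHarmonicBasis Y) (hd : Odd d) (ha : 0 < a)
    (hc : Summable fun q => ‖c q‖ ^ 2 * (a ^ (2 * q.2) + b ^ (2 * q.2)))
    {g : ℂ → Sph d → ℂ} {s : ℝ} (hs : s ∈ Set.Icc a b)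
    (hg : slice g s =ᵐ[circSphMeasure d] synthesis hY hd (modeVec c s)) (p : HarmIndex d) (m : ℤ) :
    laurentCoeff (coeff Y g p) s m = c (p, m) := by
  have hs0 : 0 < s := ha.trans_le hs.1
  have hs' : (s : ℂ) ≠ 0 := by exact_mod_cast hs0.ne'
  have hρ : (rootTwoPi : ℂ) ≠ 0 := by exact_mod_cast rootTwoPi_pos.ne'
  have hmem : MemLp (slice g s) 2 (circSphMeasure d) := (memLp_congr_ae hg).2 (Lp.memLp _)
  have h := inner_harmModeLp_synthesis hY hd (modeVec c s) (p, m)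
  rw [modeVec_apply ha hc hs, L2.inner_def] at h
  have h1 : ∫ x, inner ℂ (harmModeLp hY hd (p, m) x) (synthesis hY hd (modeVec c s) x)
      ∂(circSphMeasure d) = ∫ x : ℝ × Sph d, ((rootTwoPi : ℂ)⁻¹ *
        Complex.exp (x.1 * Complex.I) ^ (-m)) * (slice g s x * ((Y p.1 p.2 x.2 : ℝ) : ℂ))
      ∂(circSphMeasure d) := by
    refine integral_congr_ae ?_
    filter_upwards [hg, BoundedContinuousFunction.coeFn_toLp 2 (circSphMeasure d) ℂ
      (harmMode hY hd (p, m))] with x hx hx'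
    rw [harmModeLp, hx', ← hx, RCLike.inner_apply, conj_harmMode]
    ring
  have hint : Integrable (fun x : ℝ × Sph d => ((rootTwoPi : ℂ)⁻¹ *
      Complex.exp (x.1 * Complex.I) ^ (-m)) * (slice g s x * ((Y p.1 p.2 x.2 : ℝ) : ℂ)))
      (circSphMeasure d) := by
    refine (integrable_slice_mul hmem hY hd p).bdd_mul (c := rootTwoPi⁻¹) ?_
      (ae_of_all _ fun x => ?_)
    · have : Continuous fun x : ℝ × Sph d => Complex.exp (x.1 * Complex.I) := by fun_prop
      exact (continuous_const.mul (this.zpow₀ _ fun x =>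
        Or.inl (Complex.exp_ne_zero _))).aestronglyMeasurable
    · rw [norm_mul, norm_zpow, Complex.norm_exp_ofReal_mul_I, one_zpow, mul_one, norm_inv,
        Complex.norm_real, Real.norm_of_nonneg rootTwoPi_pos.le]
  rw [h1, circSphMeasure, integral_prod _ hint] at h
  simp_rw [integral_const_mul] at h
  have h2 : laurentCoeff (coeff Y g p) s m = ((s : ℂ) ^ m)⁻¹ * (rootTwoPi : ℂ)⁻¹ *
      ∫ φ : ℝ in Set.Ioc 0 (2 * Real.pi), (rootTwoPi : ℂ)⁻¹ * Complex.exp (φ * Complex.I) ^ (-m) *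
        ∫ θ : Sph d, slice g s (φ, θ) * ((Y p.1 p.2 θ : ℝ) : ℂ) ∂(sphMeasure d) := by
    rw [laurentCoeff, Real.circleAverage_def, intervalIntegral.integral_of_le Real.two_pi_pos.le,
      Complex.real_smul, ← integral_const_mul, ← integral_const_mul, ← rootTwoPi_sq]
    refine integral_congr_ae (ae_of_all _ fun φ => ?_)
    simp only [coeff, slice, circleMap, zero_add, mul_zpow, zpow_neg]
    push_cast
    field_simp
  rw [h2, h]
  have : (s : ℂ) ^ m ≠ 0 := zpow_ne_zero _ hs'
  field_simp

end Limit

/-! ### The reproducing property -/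

lemma hasSum_circleAverage_compKernel_mul {d k : ℕ} (hd : Odd d) {a b s : ℝ} (ha : 0 < a)
    (hab : a < b) (hs : s = a ∨ s = b) {z : ℂ} (hz : z ∈ annulus a b) {h : ℂ → ℂ}
    (hh : CircleIntegrable h 0 s) :
    HasSum (fun m => (kerExponents d k a s).indicator (fun m => z ^ m * laurentCoeff h s m) m)
      (Real.circleAverage (fun τ => compKernel d k a b z τ * h τ) 0 s) := by
  have hs0 : 0 < s := by
    rcases hs with rfl | rfl
    exacts [ha, ha.trans hab]
  have hw := summable_radialWeight ha hz
  have hz0 : z ≠ 0 := norm_pos_iff.1 (ha.trans hz.1)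
  have hint : IntervalIntegrable (fun φ => h (circleMap 0 s φ)) volume 0 (2 * Real.pi) := hh
  have key := intervalIntegral.hasSum_integral_of_dominated_convergence (μ := volume) (a := 0)
    (b := 2 * Real.pi)
    (F := fun (m : ℤ) φ => (kerExponents d k a s).indicator (fun m => (z / circleMap 0 s φ) ^ m) m *
      h (circleMap 0 s φ))
    (f := fun φ => compKernel d k a b z (circleMap 0 s φ) * h (circleMap 0 s φ))
    (fun m φ => radialWeight a b ‖z‖ m * ‖h (circleMap 0 s φ)‖)
    (fun m => by
      refine AEStronglyMeasurable.mul ?_ ?_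
      · by_cases hm : m ∈ kerExponents d k a s
        · simp only [Set.indicator_of_mem hm]
          have hc : ∀ φ, circleMap 0 s φ ≠ 0 := fun φ => circleMap_ne_center hs0.ne'
          exact ((continuous_const.div (continuous_circleMap 0 s) hc).zpow₀ m fun φ =>
            Or.inl (div_ne_zero hz0 (hc φ))).aestronglyMeasurable
        · simp only [Set.indicator_of_notMem hm]
          exact aestronglyMeasurable_const
      · rw [Set.uIoc_of_le Real.two_pi_pos.le]
        exact hint.1.aestronglyMeasurable)
    (fun m => ae_of_all _ fun φ _ => by
      rw [norm_mul]
      gcongr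
      exact norm_indicator_zpow_le ha hab hs hz (norm_circleMap_zero_of_pos hs0 φ) m)
    (ae_of_all _ fun φ _ => hw.mul_right _)
    (by
      simp_rw [tsum_mul_right]
      exact hint.norm.const_mul _)
    (ae_of_all _ fun φ _ =>
      (hasSum_compKernel hd ha hab hs hz (norm_circleMap_zero_of_pos hs0 φ)).mul_right _)
  have key2 := key.const_smul ((2 * Real.pi)⁻¹ : ℝ)
  rw [Real.circleAverage_def]
  refine key2.congr_fun fun m => ?_
  by_cases hm : m ∈ kerExponents d k a s
  · simp only [Set.indicator_of_mem hm, laurentCoeff, Real.circleAverage_def]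
    rw [mul_smul_comm, ← intervalIntegral.integral_const_mul]
    congr 2
    ext φ
    rw [div_zpow, zpow_neg]
    ring
  · simp [Set.indicator_of_notMem hm]

lemma sqrt_mul_le_add {N y t : ℝ} (hN : 0 ≤ N) (ht : 0 < t) :
    Real.sqrt N * y ≤ N * t + t⁻¹ * y ^ 2 := by
  have h1 : (Real.sqrt N) ^ 2 = N := Real.sq_sqrt hN
  have h2 : 0 ≤ t * (Real.sqrt N - t⁻¹ * y) ^ 2 := by positivity
  have h3 : t * (Real.sqrt N - t⁻¹ * y) ^ 2 =
      N * t - 2 * (Real.sqrt N * y) + t⁻¹ * y ^ 2 := by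
    have : t * (Real.sqrt N - t⁻¹ * y) ^ 2 =
      (Real.sqrt N) ^ 2 * t - 2 * (t * t⁻¹) * (Real.sqrt N * y) + (t * t⁻¹) * t⁻¹ * y ^ 2 := by ring
    rw [this, mul_inv_cancel₀ ht.ne', h1]
    ring
  have h4 : 0 ≤ N * t + t⁻¹ * y ^ 2 := by positivity
  linarith

section Components

variable {d : ℕ} {Y : (k : ℕ) → Fin (harmDim d k) → EuclideanSpace ℝ (Fin d) → ℝ}
variable {a b L : ℝ} {F : HarmIndex d → ℂ → ℂ}

lemma summable_annCoeff_sq (ha : 0 < a) (hab : a < b) (hL : 1 < L)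
    (hF : ∀ p, MemHardy a b (F p))
    (hsum : Summable fun p : HarmIndex d => hardyNormSq a b (F p) * L ^ (2 * p.1)) :
    Summable fun q : HarmIndex d × ℤ =>
      ‖annCoeff a b (F q.1) q.2‖ ^ 2 * (a ^ (2 * q.2) + b ^ (2 * q.2)) := by
  have hb := ha.trans hab
  rw [summable_prod_of_nonneg (fun q => by positivity)]
  refine ⟨fun p => (hF p).summable_norm_sq ha hab, ?_⟩
  simp_rw [fun p => ((hF p).hasSum_hardyNormSq ha hab).tsum_eq]
  refine hsum.of_nonneg_of_le (fun p => (hF p).hardyNormSq_nonneg ha hab) fun p => ?_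
  exact le_mul_of_one_le_right ((hF p).hardyNormSq_nonneg ha hab) (one_le_pow₀ hL.le)

/-- On an interior circle the double series of `f` converges uniformly, hence in `L²`. -/
lemma slice_ae_eq_synthesis (hY : IsHarmonicBasis Y) (hd : Odd d) (ha : 0 < a) (hab : a < b)
    (hL : 1 < L) (hF : ∀ p, MemHardy a b (F p))
    (hsum : Summable fun p : HarmIndex d => hardyNormSq a b (F p) * L ^ (2 * p.1))
    {f : ℂ → Sph d → ℂ}
    (hf : ∀ z ∈ annulus a b, ∀ θ : Sph d,
      HasSum (fun p : HarmIndex d => F p z * ((Y p.1 p.2 θ : ℝ) : ℂ)) (f z θ))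
    {r : ℝ} (hr : r ∈ Set.Ioo a b) :
    slice f r =ᵐ[circSphMeasure d]
      synthesis hY hd (modeVec (fun q => annCoeff a b (F q.1) q.2) r) := by
  have hr0 : 0 < r := ha.trans hr.1
  have hL0 : 0 < L := by linarith
  have hρ := rootTwoPi_pos
  have hρ' : (rootTwoPi : ℂ) ≠ 0 := by exact_mod_cast hρ.ne'
  set c : HarmIndex d × ℤ → ℂ := fun q => annCoeff a b (F q.1) q.2
  have hc := summable_annCoeff_sq ha hab hL hF hsum
  set x := modeVec c r
  have hx : ∀ q, x q = (rootTwoPi : ℂ) * (c q * (r : ℂ) ^ q.2) := fun q =>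
    modeVec_apply ha hc ⟨hr.1.le, hr.2.le⟩ q
  have hsq : Summable fun p : HarmIndex d =>
      Real.sqrt (hardyNormSq a b (F p)) * harmBound d p.1 := by
    refine (hsum.add (summable_harmBound_sq hL)).of_nonneg_of_le
      (fun p => mul_nonneg (Real.sqrt_nonneg _) (harmBound_nonneg _ _)) fun p => ?_
    exact sqrt_mul_le_add ((hF p).hardyNormSq_nonneg ha hab) (by positivity)
  have hprod := hsq.mul_of_nonneg (summable_radialWeight ha hr)
    (fun p => mul_nonneg (Real.sqrt_nonneg _) (harmBound_nonneg _ _))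
    (fun m => radialWeight_nonneg ha hr m)
  -- absolute convergence in the sup norm, hence convergence both pointwise and in `L²`
  have hbcf : Summable fun q => x q • harmMode hY hd q := by
    refine hprod.of_norm_bounded fun q => ?_
    rw [norm_smul, hx, norm_mul, norm_mul, norm_zpow, Complex.norm_real, Complex.norm_real,
      Real.norm_of_nonneg hρ.le, Real.norm_of_nonneg hr0.le]
    calc rootTwoPi * (‖c q‖ * r ^ q.2) * ‖harmMode hY hd q‖
        ≤ rootTwoPi * (Real.sqrt (hardyNormSq a b (F q.1)) * radialWeight a b r q.2) *
            (rootTwoPi⁻¹ * harmBound d q.1.1) := by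
          have h1 := (hF q.1).norm_annCoeff_mul_zpow_le ha hab hr q.2
          have h2 := norm_harmMode_le hY hd q
          have h3 := radialWeight_nonneg ha hr q.2
          gcongr
      _ = _ := by
          field_simp
  obtain ⟨G, hG⟩ := hbcf
  have hLp : synthesis hY hd x = BoundedContinuousFunction.toLp 2 (circSphMeasure d) ℂ G := by
    have h1 := hG.mapL (BoundedContinuousFunction.toLp 2 (circSphMeasure d) ℂ)
    refine (hasSum_synthesis hY hd x).unique (h1.congr_fun fun q => ?_)
    rw [map_smul]
    rfl
  have hG' : ∀ y, slice f r y = G y := by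
    intro y
    have h1 := hG.mapL (BoundedContinuousFunction.evalCLM ℂ y)
    have hz : circleMap 0 r y.1 ∈ annulus a b :=
      sphere_subset_annulus hr (by simp [abs_of_pos hr0])
    have h2 : HasSum (fun q : HarmIndex d × ℤ =>
        c q * circleMap 0 r y.1 ^ q.2 * ((Y q.1.1 q.1.2 y.2 : ℝ) : ℂ)) (G y) := by
      refine h1.congr_fun fun q => ?_
      simp only [map_smul, BoundedContinuousFunction.evalCLM_apply, smul_eq_mul]
      rw [hx, harmMode_apply, circleMap, zero_add, mul_zpow]
      field_simp
    have h3 := h2.prod_fiberwise fun p =>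
      ((hF p).hasSum_annCoeff ha hab hz).mul_right ((Y p.1 p.2 y.2 : ℝ) : ℂ)
    exact (hf _ hz y.2).unique h3
  rw [hLp]
  filter_upwards [BoundedContinuousFunction.coeFn_toLp 2 (circSphMeasure d) ℂ G] with y hy
  rw [hy, hG']

/-- The Cauchy type kernel of one component space reproduces from the Laurent coefficients on the
boundary. -/
lemma circleAverage_add_circleAverage_compKernel {k : ℕ} (hd : Odd d) (ha : 0 < a) (hab : a < b)
    {f : ℂ → ℂ} (hf : MemComponent d k a b f) {h : ℂ → ℂ}
    (hint : ∀ s, s = a ∨ s = b → CircleIntegrable h 0 s)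
    (hcoeff : ∀ s, s = a ∨ s = b → ∀ m, laurentCoeff h s m = annCoeff a b f m)
    {z : ℂ} (hz : z ∈ annulus a b) :
    Real.circleAverage (fun τ => compKernel d k a b z τ * h τ) 0 b +
      Real.circleAverage (fun τ => compKernel d k a b z τ * h τ) 0 a = f z := by
  have hA := hasSum_circleAverage_compKernel_mul (k := k) hd ha hab (Or.inl rfl) hz
    (hint a (Or.inl rfl))
  have hB := hasSum_circleAverage_compKernel_mul (k := k) hd ha hab (Or.inr rfl) hz
    (hint b (Or.inr rfl))
  refine (hB.add hA).unique ((hf.1.hasSum_annCoeff ha hab hz).congr_fun fun m => ?_)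
  by_cases hm : m ∈ exponents d k
  · rcases lt_or_ge m 0 with h0 | h0
    · have h1 : m ∈ kerExponents d k a a := ⟨hm, iff_of_true h0 rfl⟩
      have h2 : m ∉ kerExponents d k a b := fun h => hab.ne' (h.2.1 h0)
      rw [Set.indicator_of_mem h1, Set.indicator_of_notMem h2, hcoeff a (Or.inl rfl)]
      ring
    · have h1 : m ∉ kerExponents d k a a := fun h => not_lt.2 h0 (h.2.2 rfl)
      have h2 : m ∈ kerExponents d k a b := ⟨hm, iff_of_false (not_lt.2 h0) hab.ne'⟩
      rw [Set.indicator_of_notMem h1, Set.indicator_of_mem h2, hcoeff b (Or.inr rfl)]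
      ring
  · rw [Set.indicator_of_notMem fun h => hm h.1, Set.indicator_of_notMem fun h => hm h.1,
      hf.annCoeff_eq_zero ha hab hm]
    ring

end Components

end PolyHardy

end

theorem mainTheorem3 (d : ℕ) (hd : Odd d) (a b L : ℝ) (ha : 0 < a) (hab : a < b) (hL : 1 < L)
    (Y : (k : ℕ) → Fin (PolyHardy.harmDim d k) → EuclideanSpace ℝ (Fin d) → ℝ)
    (hY : PolyHardy.IsHarmonicBasis Y) :
    (∀ z ∈ PolyHardy.annulus a b, ∀ θ : PolyHardy.Sph d,
      ∀ τ : ℂ, ‖τ‖ = a ∨ ‖τ‖ = b → ∀ θ' : PolyHardy.Sph d,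
        Summable (PolyHardy.kernelTerm Y a b L z θ τ θ')) ∧
    ∀ f : ℂ → PolyHardy.Sph d → ℂ, PolyHardy.MemPolyHardy Y a b L f →
      (∃ fstar : ℂ → PolyHardy.Sph d → ℂ, PolyHardy.IsBoundaryLimit a b f fstar) ∧
      ∀ fstar : ℂ → PolyHardy.Sph d → ℂ, PolyHardy.IsBoundaryLimit a b f fstar →
        ∀ z ∈ PolyHardy.annulus a b, ∀ θ : PolyHardy.Sph d,
          PolyHardy.HasPairing Y a b L (PolyHardy.cauchyKernel Y a b L z θ) fstar (f z θ) := by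
  refine ⟨fun z hz θ τ hτ θ' => PolyHardy.summable_kernelTerm hY hd ha hab hL hz hτ θ θ', ?_⟩
  rintro f ⟨F, hF, hsum, hf⟩
  have hc := PolyHardy.summable_annCoeff_sq ha hab hL (fun p => (hF p).1) hsum
  have hslice : ∀ r ∈ Set.Ioo a b, _ := fun r hr =>
    PolyHardy.slice_ae_eq_synthesis hY hd ha hab hL (fun p => (hF p).1) hsum hf hr
  refine ⟨PolyHardy.exists_isBoundaryLimit hY hd ha hab hc hslice, fun g hg z hz θ => ?_⟩
  refine ⟨⟨PolyHardy.memLp_slice_cauchyKernel hY hd ha hab hL (Or.inl rfl) hz θ,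
    PolyHardy.memLp_slice_cauchyKernel hY hd ha hab hL (Or.inr rfl) hz θ⟩, hg.1, ?_⟩
  have hmem : ∀ s, s = a ∨ s = b →
      MemLp (PolyHardy.slice g s) 2 (PolyHardy.circSphMeasure d) := by
    rintro s (rfl | rfl)
    exacts [hg.1.1, hg.1.2]
  have hIcc : ∀ s, s = a ∨ s = b → s ∈ Set.Icc a b := by
    rintro s (rfl | rfl)
    exacts [⟨le_rfl, hab.le⟩, ⟨hab.le, le_rfl⟩]
  refine (hf z hz θ).congr_fun fun p => ?_
  have hrep := PolyHardy.circleAverage_add_circleAverage_compKernel hd ha hab (hF p)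
    (fun s hs => PolyHardy.circleIntegrable_coeff (hmem s hs) hY hd p)
    (fun s hs m => PolyHardy.laurentCoeff_coeff hY hd ha hc (hIcc s hs)
      (hg.slice_ae_eq hY hd ha hab hc hslice hs) p m) hz
  have hL0 : (L : ℂ) ^ (2 * p.1) ≠ 0 := by
    have : L ≠ 0 := by linarith
    exact pow_ne_zero _ (by exact_mod_cast this)
  have havg : ∀ s, s = a ∨ s = b →
      Real.circleAverage (fun τ => PolyHardy.coeff Y (PolyHardy.cauchyKernel Y a b L z θ) p τ *
        PolyHardy.coeff Y g p τ) 0 s =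
      (((L : ℂ) ^ (2 * p.1))⁻¹ * ((Y p.1 p.2 θ : ℝ) : ℂ)) *
        Real.circleAverage (fun τ => PolyHardy.compKernel d p.1 a b z τ *
          PolyHardy.coeff Y g p τ) 0 s := by
    intro s hs
    have hs0 : 0 < s := ha.trans_le (hIcc s hs).1
    rw [← smul_eq_mul (((L : ℂ) ^ (2 * p.1))⁻¹ * _), ← Real.circleAverage_smul]
    refine Real.circleAverage_congr_sphere fun τ hτ => ?_
    rw [mem_sphere_zero_iff_norm, abs_of_pos hs0] at hτ
    simp only [Pi.smul_apply, smul_eq_mul]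
    rw [PolyHardy.coeff_cauchyKernel hY hd ha hab hL hz (hτ.symm ▸ hs) θ p]
    ring
  rw [PolyHardy.circPairing, havg a (Or.inl rfl), havg b (Or.inr rfl), ← mul_add, hrep]
  field_simp
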